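/- Let $G$ be a unimodular locally compact (Hausdorff) group, let $U$ be a compact open subgroup of $G$, and let $\mu$ be the Haar measure on $G$ with $\mu(U)=1$. Let $L^1(G)$ be the Banach $*$-algebra of (classes of) $\mu$-integrable functions with convolution $(f_1*f_2)(g)=\int_G f_1(h)f_2(h^{-1}g)\,d\mu(h)$ and involution $f^*(g)=\overline{f(g^{-1})}$, and let $L^1(G,U)=L^1(U\backslash G/U)$ be its closed $*$-subalgebra of $U$-biinvariant functions. Assume that $(G,U)$ is a Gelfand pair, i.e. that $L^1(U\backslash G/U)$ is commutative. For a Banach $*$-algebra $A$ let $C^*(A)$ denote its enveloping $C^*$-algebra, i.e. the Hausdorff completion of $A$ in the seminorm $a\mapsto\sup_\pi\|\pi(a)\|$, where $\pi$ runs over the $*$-representations of $A$ on Hilbert spaces, and put $C^*(G)=C^*(L^1(G))$. Let $p_0=\chi_U$, a self-adjoint projection in $L^1(G)$ (and, via the canonical map, in $C^*(G)$); then $L^1(G,U)=p_0L^1(G)p_0$. The inclusion $L^1(G,U)\subseteq L^1(G)$ induces the canonical surjective $*$-homomorphism $\Pi: C^*(L^1(G,U))\to p_0C^*(G)p_0$.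 A $*$-spherical function is a continuous function $\omega:G\to\mathbb{C}$ such that $\omega(e)=1$; $\omega(u_1gu_2)=\omega(g)$ for all $g\in G$, $u_1,u_2\in U$; $\int_U\omega(g_1ug_2)\,d\mu(u)=\omega(g_1)\omega(g_2)$ for all $g_1,g_2\in G$; and $\omega(g^{-1})=\overline{\omega(g)}$ for all $g\in G$. Such a function is positive definite if $\sum_{j,k=1}^m\omega(s_j^{-1}s_k)\overline{z_j}z_k\ge 0$ for all $m\ge 1$, $s_1,\dots,s_m\in G$ and $z_1,\dots,z_m\in\mathbb{C}$. Then the following are equivalent: (a) every bounded $*$-spherical function is positive definite; (b) the canonical surjection $\Pi: C^*(L^1(G,U))\to p_0C^*(G)p_0$ is an isomorphism. -/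

import Mathlib

open MeasureTheory Measure Filter Topology
open scoped ENNReal ComplexOrder ComplexConjugate

universe u

set_option linter.unusedSectionVars false

namespace GelfandPair

section Envelope

variable {A : Type u} [NonUnitalNormedRing A] [StarRing A] [NormedSpace ℂ A]
  [IsScalarTower ℂ A A] [SMulCommClass ℂ A A] [CompleteSpace A] [NormedStarGroup A]
variable {B : Type u} [NonUnitalNormedRing B] [StarRing B] [NormedSpace ℂ B]
  [IsScalarTower ℂ B B] [SMulCommClass ℂ B B] [CompleteSpace B] [NormedStarGroup B]

variable (A) in
/-- The `*`-representations of a Banach `*`-algebra `A` by bounded operators on Hilbert spaces.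
The Hilbert spaces are taken in the universe of `A`, which contains all cyclic representations. -/
structure StarRep where
  /-- The Hilbert space. -/
  H : Type u
  [instNorm : NormedAddCommGroup H]
  [instInner : InnerProductSpace ℂ H]
  [instComplete : CompleteSpace H]
  /-- The representation. -/
  toHom : A →⋆ₙₐ[ℂ] (H →L[ℂ] H)

attribute [instance] StarRep.instNorm StarRep.instInner StarRep.instComplete

/-- A `*`-representation of a Banach `*`-algebra is automatically contractive. -/
theorem StarRep.norm_le (ρ : StarRep A) (a : A) : ‖ρ.toHom a‖ ≤ ‖a‖ := by
  have key : ∀ b : A, IsSelfAdjoint b → ‖ρ.toHom b‖ ≤ ‖b‖ := by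
    intro b hb
    have hsa : IsSelfAdjoint (ρ.toHom b) := hb.map ρ.toHom
    have h1 : spectralRadius ℂ (ρ.toHom b) ≤ ‖b‖ₑ := by
      refine iSup₂_le fun z hz => ?_
      have h2 : z ∈ quasispectrum ℂ b :=
        NonUnitalAlgHom.quasispectrum_apply_subset (R := ℂ) ρ.toHom b
          (spectrum_subset_quasispectrum ℂ _ hz)
      rw [Unitization.quasispectrum_eq_spectrum_inr' ℂ ℂ,
        ← AlgEquiv.spectrum_eq (WithLp.unitizationAlgEquiv (𝕜 := ℂ) (A := A) ℂ).symm] at h2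
      have h3 := spectrum.norm_le_norm_mul_of_mem h2
      have h4 : ‖(1 : WithLp 1 (Unitization ℂ A))‖ = 1 := by
        rw [WithLp.unitization_norm_def]
        change ‖(1 : Unitization ℂ A).fst‖ + ‖(1 : Unitization ℂ A).snd‖ = 1
        simp
      have h5 : ‖(WithLp.unitizationAlgEquiv (𝕜 := ℂ) (A := A) ℂ).symm (b : Unitization ℂ A)‖ = ‖b‖ :=
        WithLp.unitization_norm_inr b
      rw [h4, mul_one, h5] at h3
      exact_mod_cast h3
    rw [hsa.spectralRadius_eq_nnnorm] at h1
    exact_mod_cast h1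
  have h := key (star a * a) (.star_mul_self a)
  rw [map_mul, map_star, CStarRing.norm_star_mul_self] at h
  have h' : ‖star a * a‖ ≤ ‖a‖ * ‖a‖ := by
    simpa using norm_mul_le (star a) a
  exact abs_le_of_sq_le_sq' (by nlinarith) (norm_nonneg _) |>.2

/-- Restriction of a `*`-representation along a `*`-homomorphism. -/
noncomputable def StarRep.comp (ρ : StarRep B) (φ : A →⋆ₙₐ[ℂ] B) : StarRep A where
  H := ρ.H
  toHom := ρ.toHom.comp φ

variable (A) in
/-- The `C^*`-algebra of bounded families of operators `(x_ρ)_ρ`, `x_ρ ∈ B(H_ρ)`, indexed by the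
`*`-representations `ρ` of `A`, with the supremum norm. -/
def RepProd : Type (u + 1) := lp (fun ρ : StarRep A => ρ.H →L[ℂ] ρ.H) ∞

noncomputable instance : NonUnitalCStarAlgebra (RepProd A) :=
  inferInstanceAs (NonUnitalCStarAlgebra (lp (fun ρ : StarRep A => ρ.H →L[ℂ] ρ.H) ∞))

/-- The component of a bounded family at the representation `ρ`. -/
def RepProd.eval (x : RepProd A) (ρ : StarRep A) : ρ.H →L[ℂ] ρ.H := x.1 ρ

theorem RepProd.ext {x y : RepProd A} (h : ∀ ρ, x.eval ρ = y.eval ρ) : x = y :=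
  Subtype.ext (funext h)

theorem RepProd.norm_eval_le (x : RepProd A) (ρ : StarRep A) : ‖x.eval ρ‖ ≤ ‖x‖ :=
  lp.norm_apply_le_norm ENNReal.top_ne_zero (E := fun ρ : StarRep A => ρ.H →L[ℂ] ρ.H) x ρ

theorem RepProd.norm_le {x : RepProd A} {c : ℝ} (hc : 0 ≤ c) (h : ∀ ρ, ‖x.eval ρ‖ ≤ c) :
    ‖x‖ ≤ c :=
  lp.norm_le_of_forall_le (E := fun ρ : StarRep A => ρ.H →L[ℂ] ρ.H) hc h

/-- A uniformly bounded family as an element of `RepProd A`. -/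
def RepProd.mk (x : ∀ ρ : StarRep A, ρ.H →L[ℂ] ρ.H) (c : ℝ) (h : ∀ ρ, ‖x ρ‖ ≤ c) : RepProd A :=
  ⟨x, memℓp_infty ⟨c, by rintro _ ⟨ρ, rfl⟩; exact h ρ⟩⟩

variable (A) in
/-- The universal representation `a ↦ (ρ(a))_ρ`. -/
noncomputable def universalRep : A →⋆ₙₐ[ℂ] RepProd A where
  toFun a := RepProd.mk (fun ρ => ρ.toHom a) ‖a‖ fun ρ => ρ.norm_le a
  map_smul' c a := RepProd.ext fun ρ => map_smul ρ.toHom c a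
  map_zero' := RepProd.ext fun ρ => map_zero ρ.toHom
  map_add' a b := RepProd.ext fun ρ => map_add ρ.toHom a b
  map_mul' a b := RepProd.ext fun ρ => map_mul ρ.toHom a b
  map_star' a := RepProd.ext fun ρ => map_star ρ.toHom a

variable (A) in
/-- The closure of the image of `A` in the universal representation. -/
noncomputable def cstarEnvSubalgebra : NonUnitalStarSubalgebra ℂ (RepProd A) :=
  (NonUnitalStarAlgHom.range (universalRep A)).topologicalClosure

variable (A) in
/-- The enveloping `C^*`-algebra `C^*(A)` of a Banach `*`-algebra `A`: the closure of the image of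
`A` in the universal representation, i.e. the Hausdorff completion of `A` in the seminorm
`a ↦ sup_ρ ‖ρ(a)‖`. -/
def CStarEnv : Type (u + 1) := cstarEnvSubalgebra A

noncomputable instance : NonUnitalCStarAlgebra (CStarEnv A) :=
  NonUnitalStarSubalgebra.nonUnitalCStarAlgebra (cstarEnvSubalgebra A)
    (h_closed := NonUnitalStarSubalgebra.isClosed_topologicalClosure _)

variable (A) in
/-- The inclusion of `C^*(A)` in the algebra of bounded families. -/
noncomputable def CStarEnv.incl : CStarEnv A →⋆ₙₐ[ℂ] RepProd A :=
  NonUnitalStarSubalgebraClass.subtype (cstarEnvSubalgebra A)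

variable (A) in
/-- The canonical map `A → C^*(A)`. -/
noncomputable def toCStarEnv : A →⋆ₙₐ[ℂ] CStarEnv A :=
  NonUnitalStarAlgHom.codRestrict (universalRep A) (cstarEnvSubalgebra A) fun a =>
    NonUnitalStarSubalgebra.le_topologicalClosure _ ⟨a, rfl⟩

/-- Restriction of families: `(x_σ)_σ ↦ (x_{ρ ∘ φ})_ρ`. -/
noncomputable def repProdMap (φ : A →⋆ₙₐ[ℂ] B) : RepProd A →⋆ₙₐ[ℂ] RepProd B where
  toFun x := RepProd.mk (fun ρ => x.eval (ρ.comp φ)) ‖x‖ fun ρ => x.norm_eval_le (ρ.comp φ)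
  map_smul' _ _ := RepProd.ext fun _ => rfl
  map_zero' := RepProd.ext fun _ => rfl
  map_add' _ _ := RepProd.ext fun _ => rfl
  map_mul' _ _ := RepProd.ext fun _ => rfl
  map_star' _ := RepProd.ext fun _ => rfl

theorem repProdMap_universalRep (φ : A →⋆ₙₐ[ℂ] B) (a : A) :
    repProdMap φ (universalRep A a) = universalRep B (φ a) := RepProd.ext fun _ => rfl

theorem continuous_repProdMap (φ : A →⋆ₙₐ[ℂ] B) : Continuous (repProdMap φ) :=
  AddMonoidHomClass.continuous_of_bound (repProdMap φ) 1 fun x => by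
    rw [one_mul]
    exact RepProd.norm_le (norm_nonneg _) fun ρ => x.norm_eval_le (ρ.comp φ)

theorem repProdMap_mem (φ : A →⋆ₙₐ[ℂ] B) {x : RepProd A} (hx : x ∈ cstarEnvSubalgebra A) :
    repProdMap φ x ∈ cstarEnvSubalgebra B := by
  refine map_mem_closure (continuous_repProdMap φ) hx ?_
  rintro _ ⟨a, rfl⟩
  exact ⟨φ a, (repProdMap_universalRep φ a).symm⟩

/-- The `*`-homomorphism `C^*(φ) : C^*(A) → C^*(B)` induced by a `*`-homomorphism `φ : A → B`; it is
the continuous map determined by `C^*(φ)(a) = φ(a)` for `a ∈ A`. -/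
noncomputable def CStarEnv.map (φ : A →⋆ₙₐ[ℂ] B) : CStarEnv A →⋆ₙₐ[ℂ] CStarEnv B :=
  NonUnitalStarAlgHom.codRestrict ((repProdMap φ).comp (CStarEnv.incl A)) (cstarEnvSubalgebra B)
    fun x => repProdMap_mem φ x.2

theorem CStarEnv.map_toCStarEnv (φ : A →⋆ₙₐ[ℂ] B) (a : A) :
    CStarEnv.map φ (toCStarEnv A a) = toCStarEnv B (φ a) :=
  Subtype.ext (repProdMap_universalRep φ a)

theorem CStarEnv.continuous_map (φ : A →⋆ₙₐ[ℂ] B) : Continuous (CStarEnv.map φ) :=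
  ((continuous_repProdMap φ).comp continuous_subtype_val).subtype_mk _

theorem denseRange_toCStarEnv : DenseRange (toCStarEnv A) := by
  rintro ⟨x, hx⟩
  refine closure_subtype.2 ?_
  refine closure_mono ?_ hx
  rintro _ ⟨a, rfl⟩
  exact ⟨toCStarEnv A a, ⟨a, rfl⟩, rfl⟩

end Envelope

section Corner

variable {C : Type*} [NonUnitalCStarAlgebra C]

/-- The corner `pCp` of a `C^*`-algebra `C` at a projection `p`. -/
def corner (p : C) (hp : IsStarProjection p) : NonUnitalStarSubalgebra ℂ C where
  carrier := {x | ∃ c, x = p * c * p}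
  zero_mem' := ⟨0, by simp⟩
  add_mem' := by
    rintro _ _ ⟨a, rfl⟩ ⟨b, rfl⟩
    exact ⟨a + b, by rw [mul_add, add_mul]⟩
  mul_mem' := by
    rintro _ _ ⟨a, rfl⟩ ⟨b, rfl⟩
    exact ⟨a * p * p * b, by simp only [mul_assoc]⟩
  smul_mem' := by
    rintro c _ ⟨a, rfl⟩
    exact ⟨c • a, by rw [mul_smul_comm, smul_mul_assoc]⟩
  star_mem' := by
    rintro _ ⟨a, rfl⟩
    exact ⟨star a, by simp only [star_mul, hp.isSelfAdjoint.star_eq, mul_assoc]⟩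

theorem mem_corner_iff (p : C) (hp : IsStarProjection p) (x : C) :
    x ∈ corner p hp ↔ p * x * p = x := by
  constructor
  · rintro ⟨c, rfl⟩
    have h := hp.isIdempotentElem.eq
    rw [← mul_assoc, ← mul_assoc, h, mul_assoc, h]
  · exact fun h => ⟨x, h.symm⟩

end Corner
/-- The group algebra `L¹(G)` of a unimodular locally compact group `G`: Mathlib's space
`Lp ℂ 1 μ` of classes of integrable functions, which is given below the convolution as
multiplication and `f^*(x) = conj (f (x⁻¹))` as involution. -/
def L1 {G : Type u} [MeasurableSpace G] (μ : Measure G) : Type u := Lp ℂ 1 μ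

/-- The class `f` as an element of Mathlib's `Lp ℂ 1 μ`. -/
def L1.toLp {G : Type u} [MeasurableSpace G] {μ : Measure G} (f : L1 μ) : Lp ℂ 1 μ := f

noncomputable instance L1.instNormedAddCommGroup {G : Type u} [MeasurableSpace G]
    (μ : Measure G) : NormedAddCommGroup (L1 μ) :=
  inferInstanceAs (NormedAddCommGroup (Lp ℂ 1 μ))

section GroupAlgebra

variable {G : Type u} [Group G] [TopologicalSpace G] [IsTopologicalGroup G]
  [LocallyCompactSpace G] [MeasurableSpace G] [BorelSpace G]
variable (μ : Measure G) [μ.IsHaarMeasure] [μ.Regular]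

/-- Left translation on `L¹(G)`: `(lTrans μ y f) x = f (y⁻¹ * x)`. -/
noncomputable def lTrans (y : G) : Lp ℂ 1 μ →ₗᵢ[ℂ] Lp ℂ 1 μ :=
  Lp.compMeasurePreservingₗᵢ ℂ (fun x => y⁻¹ * x) (measurePreserving_mul_left μ y⁻¹)

theorem lTrans_ae (y : G) (f : Lp ℂ 1 μ) : lTrans μ y f =ᵐ[μ] fun x => f (y⁻¹ * x) :=
  Lp.coeFn_compMeasurePreserving f (measurePreserving_mul_left μ y⁻¹)

theorem continuous_lTrans (f : Lp ℂ 1 μ) : Continuous fun y => lTrans μ y f := by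
  let g : C(G, C(G, G)) :=
    (ContinuousMap.mk (fun a : G × G => a.1⁻¹ * a.2) (by fun_prop)).curry
  exact (continuous_const (y := f)).compMeasurePreservingLp g.continuous
    (fun y => measurePreserving_mul_left μ y⁻¹) ENNReal.one_ne_top

/-- The convolution `(f ∗ g)(x) = ∫ f(y) g(y⁻¹ x) dμ(y)` on `L¹(G)`, written as the Bochner
integral `∫ f(y) (y · g) dμ(y)` in `L¹(G)`; `y · g` is the left translate of `g`. -/
noncomputable def conv (f g : Lp ℂ 1 μ) : Lp ℂ 1 μ := ∫ y, f y • lTrans μ y g ∂μ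

variable [μ.IsMulRightInvariant]

/-- Right translation on `L¹(G)`: `(rTrans μ y f) x = f (x * y)`. -/
noncomputable def rTrans (y : G) : Lp ℂ 1 μ →ₗᵢ[ℂ] Lp ℂ 1 μ :=
  Lp.compMeasurePreservingₗᵢ ℂ (fun x => x * y) (measurePreserving_mul_right μ y)

theorem rTrans_ae (y : G) (f : Lp ℂ 1 μ) : rTrans μ y f =ᵐ[μ] fun x => f (x * y) :=
  Lp.coeFn_compMeasurePreserving f (measurePreserving_mul_right μ y)

theorem continuous_rTrans (f : Lp ℂ 1 μ) : Continuous fun y => rTrans μ y f := by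
  let g : C(G, C(G, G)) :=
    (ContinuousMap.mk (fun a : G × G => a.2 * a.1) (by fun_prop)).curry
  exact (continuous_const (y := f)).compMeasurePreservingLp g.continuous
    (fun y => measurePreserving_mul_right μ y) ENNReal.one_ne_top

theorem isInvInvariant : μ.IsInvInvariant := by
  constructor
  let c : ℝ≥0∞ := haarScalarFactor μ.inv μ
  have hc : μ.inv = c • μ := isMulLeftInvariant_eq_smul_of_regular μ.inv μ
  have : map Inv.inv (map Inv.inv μ) = c ^ 2 • μ := by
    rw [← inv_def μ, hc, Measure.map_smul, ← inv_def μ, hc, smul_smul, pow_two]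
  have μeq : μ = c ^ 2 • μ := by
    rw [map_map continuous_inv.measurable continuous_inv.measurable] at this
    simpa only [inv_involutive, Function.Involutive.comp_self, Measure.map_id]
  have K : TopologicalSpace.PositiveCompacts G := Classical.arbitrary _
  have : c ^ 2 * μ K = 1 ^ 2 * μ K := by
    conv_rhs => rw [μeq]
    simp
  have : c ^ 2 = 1 ^ 2 :=
    (ENNReal.mul_left_inj (measure_pos_of_nonempty_interior _ K.interior_nonempty).ne'
          K.isCompact.measure_lt_top.ne).1 this
  have : c = 1 := (ENNReal.pow_right_strictMono two_ne_zero).injective this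
  rw [hc, this, one_smul]

theorem measurePreserving_inv' : MeasurePreserving (fun x : G => x⁻¹) μ μ :=
  haveI := isInvInvariant μ
  Measure.measurePreserving_inv μ

/-- The involution `f ↦ f^*`, `f^*(x) = conj (f (x⁻¹))`, of `L¹(G)` for unimodular `G`. -/
noncomputable def invol (f : Lp ℂ 1 μ) : Lp ℂ 1 μ :=
  Lp.compMeasurePreserving (fun x => x⁻¹) (measurePreserving_inv' μ) (star f)

theorem invol_ae (f : Lp ℂ 1 μ) : invol μ f =ᵐ[μ] fun x => conj (f x⁻¹) := by
  refine (Lp.coeFn_compMeasurePreserving (star f) (measurePreserving_inv' μ)).trans ?_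
  exact (measurePreserving_inv' μ).quasiMeasurePreserving.ae_eq_comp (Lp.coeFn_star f)

theorem exists_compactSupport_approx (f : Lp ℂ 1 μ) {ε : ℝ≥0∞} (hε : ε ≠ 0) :
    ∃ g : G → ℂ, eLpNorm (⇑f - g) 1 μ ≤ ε ∧ Continuous g ∧ HasCompactSupport g := by
  have h1 : ∀ g h : G → ℂ, (Continuous g ∧ HasCompactSupport g) →
      (Continuous h ∧ HasCompactSupport h) → (Continuous (g + h) ∧ HasCompactSupport (g + h)) :=
    fun g h hg hh => ⟨hg.1.add hh.1, HasCompactSupport.add hg.2 hh.2⟩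
  have h2 : ∀ g : G → ℂ, (Continuous g ∧ HasCompactSupport g) → AEStronglyMeasurable g μ :=
    fun g hg => (hg.1.integrable_of_hasCompactSupport hg.2).aestronglyMeasurable
  refine (Lp.memLp f).induction_dense ENNReal.one_ne_top
    (fun g => Continuous g ∧ HasCompactSupport g) ?_ h1 h2 hε
  intro c t ht htμ ε hε
  obtain ⟨η, ηpos, hη⟩ := exists_eLpNorm_indicator_le (μ := μ) ENNReal.one_ne_top c hε
  have hη2 : (η : ℝ≥0∞) / 2 ≠ 0 := by simp [ηpos.ne']
  obtain ⟨s, st, s_compact, s_closed, μs⟩ :=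
    ht.exists_isCompact_isClosed_sdiff_lt htμ.ne hη2
  obtain ⟨V, sV, V_open, -, hV⟩ :=
    s_closed.measurableSet.exists_isOpen_sdiff_lt (s_compact.measure_lt_top (μ := μ)).ne hη2
  obtain ⟨k, hk1, hk0, hkc, hk⟩ := exists_continuous_one_zero_of_isCompact s_compact
    V_open.isClosed_compl (Set.disjoint_compl_right_iff_subset.2 sV)
  refine ⟨fun x => k x • c, ?_, by fun_prop, hkc.smul_right⟩
  refine le_trans (eLpNorm_mono fun x => ?_) (hη ((V \ s) ∪ (t \ s)) ?_)
  · simp only [Pi.sub_apply]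
    have hb : ‖k x • c‖ ≤ ‖c‖ := by
      rw [norm_smul, Real.norm_of_nonneg (hk x).1]
      exact mul_le_of_le_one_left (norm_nonneg _) (hk x).2
    have hb' : ‖k x • c - c‖ ≤ ‖c‖ := by
      have : k x • c - c = -((1 - k x) • c) := by rw [sub_smul, one_smul]; abel
      rw [this, norm_neg, norm_smul, Real.norm_of_nonneg (by linarith [(hk x).2])]
      exact mul_le_of_le_one_left (norm_nonneg _) (by linarith [(hk x).1])
    by_cases hs : x ∈ s
    · rw [hk1 hs, Set.indicator_of_mem (st hs)]
      simp
    · by_cases hxt : x ∈ t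
      · rw [Set.indicator_of_mem hxt, Set.indicator_of_mem (Set.mem_union_right _ (Set.mem_sdiff_of_mem hxt hs))]
        exact hb'
      · rw [Set.indicator_of_notMem hxt, sub_zero]
        by_cases hxV : x ∈ V
        · rw [Set.indicator_of_mem (Set.mem_union_left _ (Set.mem_sdiff_of_mem hxV hs))]
          exact hb
        · rw [hk0 hxV]
          simp
  · refine (measure_union_le _ _).trans ?_
    calc μ (V \ s) + μ (t \ s) ≤ (η : ℝ≥0∞) / 2 + (η : ℝ≥0∞) / 2 := add_le_add hV.le μs.le
      _ = η := ENNReal.add_halves _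

theorem exists_seq_compactSupport (f : Lp ℂ 1 μ) :
    ∃ F : ℕ → G → ℂ, (∀ n, Continuous (F n) ∧ HasCompactSupport (F n)) ∧
      ∀ᵐ x ∂μ, Tendsto (fun n => F n x) atTop (𝓝 (f x)) := by
  choose g hg2 hg3 hg1 using fun n : ℕ =>
    exists_compactSupport_approx μ f (ε := ((n : ℝ≥0∞) + 1)⁻¹) (by simp)
  have hlim : Tendsto (fun n => eLpNorm (g n - ⇑f) 1 μ) atTop (𝓝 0) := by
    have h0 : Tendsto (fun n : ℕ => ((n : ℝ≥0∞) + 1)⁻¹) atTop (𝓝 0) := by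
      have := (tendsto_add_atTop_iff_nat 1).2 ENNReal.tendsto_inv_nat_nhds_zero
      simpa using this
    refine tendsto_of_tendsto_of_tendsto_of_le_of_le tendsto_const_nhds h0 (fun _ => zero_le) ?_
    intro n
    simpa only [eLpNorm_sub_comm] using hg2 n
  have hm := tendstoInMeasure_of_tendsto_eLpNorm one_ne_zero
    (fun n => ((hg3 n).integrable_of_hasCompactSupport (hg1 n)).aestronglyMeasurable)
    (Lp.aestronglyMeasurable f) hlim
  obtain ⟨ns, -, hns⟩ := hm.exists_seq_tendsto_ae
  exact ⟨fun n => g (ns n), fun n => ⟨hg3 _, hg1 _⟩, hns⟩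

theorem integrable_smul {T : G → Lp ℂ 1 μ} (hT : Continuous T) {C : ℝ} (hC : ∀ y, ‖T y‖ ≤ C)
    (f : Lp ℂ 1 μ) : Integrable (fun y => f y • T y) μ := by
  obtain ⟨F, hF, hlim⟩ := exists_seq_compactSupport μ f
  have hm : AEStronglyMeasurable (fun y => f y • T y) μ := by
    refine aestronglyMeasurable_of_tendsto_ae atTop (f := fun n y => F n y • T y) (fun n => ?_) ?_
    · exact (((hF n).1.smul hT).integrable_of_hasCompactSupport
        (hF n).2.smul_right).aestronglyMeasurable
    · filter_upwards [hlim] with y hy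
      exact hy.smul_const _
  refine ((L1.integrable_coeFn f).norm.mul_const C).mono' hm ?_
  filter_upwards with y
  rw [norm_smul]
  exact mul_le_mul_of_nonneg_left (hC y) (norm_nonneg _)

theorem integrable_conv (f g : Lp ℂ 1 μ) : Integrable (fun y => f y • lTrans μ y g) μ :=
  integrable_smul μ (continuous_lTrans μ g) (fun y => ((lTrans μ y).norm_map g).le) f

theorem conv_add_left (f g h : Lp ℂ 1 μ) : conv μ (f + g) h = conv μ f h + conv μ g h := by
  unfold conv
  rw [← integral_add (integrable_conv μ f h) (integrable_conv μ g h)]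
  refine integral_congr_ae ?_
  filter_upwards [Lp.coeFn_add f g] with y hy
  rw [hy, Pi.add_apply, add_smul]

theorem conv_smul_left (c : ℂ) (f h : Lp ℂ 1 μ) : conv μ (c • f) h = c • conv μ f h := by
  unfold conv
  rw [← integral_smul]
  refine integral_congr_ae ?_
  filter_upwards [Lp.coeFn_smul c f] with y hy
  rw [hy, Pi.smul_apply, smul_assoc]

theorem conv_add_right (f g h : Lp ℂ 1 μ) : conv μ f (g + h) = conv μ f g + conv μ f h := by
  unfold conv
  rw [← integral_add (integrable_conv μ f g) (integrable_conv μ f h)]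
  simp only [map_add, smul_add]

theorem conv_smul_right (c : ℂ) (f h : Lp ℂ 1 μ) : conv μ f (c • h) = c • conv μ f h := by
  unfold conv
  rw [← integral_smul]
  simp only [map_smul, smul_comm c]

theorem norm_conv_le (f g : Lp ℂ 1 μ) : ‖conv μ f g‖ ≤ ‖f‖ * ‖g‖ := by
  refine (norm_integral_le_integral_norm _).trans (le_of_eq ?_)
  simp only [norm_smul, LinearIsometry.norm_map]
  rw [integral_mul_const, L1.norm_eq_integral_norm f]

/-- Convolution as a continuous bilinear map. -/
noncomputable def convL : Lp ℂ 1 μ →L[ℂ] Lp ℂ 1 μ →L[ℂ] Lp ℂ 1 μ :=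
  LinearMap.mkContinuous₂
    (LinearMap.mk₂ ℂ (conv μ) (conv_add_left μ) (conv_smul_left μ) (conv_add_right μ)
      (conv_smul_right μ)) 1 (fun f g => by simpa using norm_conv_le μ f g)

theorem convL_apply (f g : Lp ℂ 1 μ) : convL μ f g = conv μ f g := rfl

theorem lTrans_mul (y z : G) (f : Lp ℂ 1 μ) : lTrans μ (y * z) f = lTrans μ y (lTrans μ z f) := by
  refine Lp.ext ?_
  refine (lTrans_ae μ (y * z) f).trans (EventuallyEq.symm ?_)
  refine (lTrans_ae μ y _).trans ?_
  have := (measurePreserving_mul_left μ y⁻¹).quasiMeasurePreserving.ae_eq_comp (lTrans_ae μ z f)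
  refine this.trans (Eventually.of_forall fun x => ?_)
  simp [mul_assoc]

theorem lTrans_conv (y : G) (f g : Lp ℂ 1 μ) :
    lTrans μ y (conv μ f g) = conv μ (lTrans μ y f) g := by
  unfold conv
  have h1 : lTrans μ y (∫ z, f z • lTrans μ z g ∂μ) = ∫ z, lTrans μ y (f z • lTrans μ z g) ∂μ :=
    ((lTrans μ y).toContinuousLinearMap.integral_comp_comm (integrable_conv μ f g)).symm
  rw [h1, ← integral_mul_left_eq_self (μ := μ) (fun z => lTrans μ y (f z • lTrans μ z g)) y⁻¹]
  refine integral_congr_ae ?_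
  filter_upwards [lTrans_ae μ y f] with z hz
  rw [hz, map_smul, ← lTrans_mul, mul_inv_cancel_left]

theorem lTrans_rTrans (y z : G) (f : Lp ℂ 1 μ) :
    rTrans μ z (lTrans μ y f) = lTrans μ y (rTrans μ z f) := by
  refine Lp.ext ?_
  refine (rTrans_ae μ z _).trans (EventuallyEq.trans ?_ (lTrans_ae μ y _).symm)
  have h1 := (measurePreserving_mul_right μ z).quasiMeasurePreserving.ae_eq_comp (lTrans_ae μ y f)
  have h2 := (measurePreserving_mul_left μ y⁻¹).quasiMeasurePreserving.ae_eq_comp (rTrans_ae μ z f)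
  refine h1.trans (EventuallyEq.trans (Eventually.of_forall fun x => ?_) h2.symm)
  simp [mul_assoc]

theorem rTrans_conv (y : G) (f g : Lp ℂ 1 μ) :
    rTrans μ y (conv μ f g) = conv μ f (rTrans μ y g) := by
  unfold conv
  have h1 : rTrans μ y (∫ z, f z • lTrans μ z g ∂μ) = ∫ z, rTrans μ y (f z • lTrans μ z g) ∂μ :=
    ((rTrans μ y).toContinuousLinearMap.integral_comp_comm (integrable_conv μ f g)).symm
  rw [h1]
  simp only [map_smul, lTrans_rTrans]

theorem conv_assoc (f g h : Lp ℂ 1 μ) : conv μ (conv μ f g) h = conv μ f (conv μ g h) := by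
  have h1 : conv μ (conv μ f g) h = ∫ y, conv μ (f y • lTrans μ y g) h ∂μ :=
    (((convL μ).flip h).integral_comp_comm (integrable_conv μ f g)).symm
  rw [h1]
  simp only [conv_smul_left, ← lTrans_conv]
  rfl

theorem setIntegral_integral {T : G → Lp ℂ 1 μ} (hT : Integrable T μ) (s : Set G) :
    ∫ x in s, (∫ y, T y ∂μ : Lp ℂ 1 μ) x ∂μ = ∫ y, ∫ x in s, T y x ∂μ ∂μ := by
  have hint : ∀ f : Lp ℂ 1 μ, IntegrableOn f s μ := fun f => (L1.integrable_coeFn f).integrableOn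
  let Λ : Lp ℂ 1 μ →L[ℂ] ℂ := LinearMap.mkContinuous
    { toFun := fun f => ∫ x in s, f x ∂μ
      map_add' := fun f g => by
        rw [← integral_add (hint f) (hint g)]
        exact integral_congr_ae (ae_restrict_of_ae (Lp.coeFn_add f g))
      map_smul' := fun c f => by
        rw [RingHom.id_apply, ← integral_smul]
        exact integral_congr_ae (ae_restrict_of_ae (Lp.coeFn_smul c f)) } 1 (fun f => by
      rw [one_mul, L1.norm_eq_integral_norm]
      refine (norm_integral_le_integral_norm _).trans ?_
      exact setIntegral_le_integral (L1.integrable_coeFn f).norm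
        (Eventually.of_forall fun x => norm_nonneg _))
  exact (Λ.integral_comp_comm hT).symm


theorem hasCompactSupport_conv {a b : G → ℂ} (ha' : HasCompactSupport a)
    (hb' : HasCompactSupport b) :
    HasCompactSupport (Function.uncurry fun y x : G => a y * b (y⁻¹ * x)) := by
  let e : G × G ≃ₜ G × G :=
    { toFun := fun p => (p.1, p.1⁻¹ * p.2)
      invFun := fun p => (p.1, p.1 * p.2)
      left_inv := fun p => by simp
      right_inv := fun p => by simp
      continuous_toFun := by fun_prop
      continuous_invFun := by fun_prop }
  have h : HasCompactSupport fun p : G × G => a p.1 * b p.2 :=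
    HasCompactSupport.intro (IsCompact.prod ha' hb') fun p hp => by
      by_cases h1 : p.1 ∈ tsupport a
      · have h2 : p.2 ∉ tsupport b := fun h2 => hp ⟨h1, h2⟩
        rw [image_eq_zero_of_notMem_tsupport h2, mul_zero]
      · rw [image_eq_zero_of_notMem_tsupport h1, zero_mul]
  exact h.comp_homeomorph e

/-- For continuous compactly supported functions the product in `L¹(G)` is given by the
usual convolution integral. -/
theorem conv_ae {a b : G → ℂ} (ha : Continuous a) (ha' : HasCompactSupport a)
    (hb : Continuous b) (hb' : HasCompactSupport b) (A B : Lp ℂ 1 μ) (hA : A =ᵐ[μ] a)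
    (hB : B =ᵐ[μ] b) : conv μ A B =ᵐ[μ] fun x => ∫ y, a y * b (y⁻¹ * x) ∂μ := by
  have hcs := hasCompactSupport_conv ha' hb'
  have hcont : Continuous (Function.uncurry fun y x : G => a y * b (y⁻¹ * x)) := by
    unfold Function.uncurry
    fun_prop
  have hI : Integrable (fun x => ∫ y, a y * b (y⁻¹ * x) ∂μ) μ := by
    refine Continuous.integrable_of_hasCompactSupport ?_ ?_
    · rw [← continuousOn_univ]
      refine continuousOn_integral_of_compact_support (μ := μ) (k := tsupport a) ha'
        (f := fun x y => a y * b (y⁻¹ * x)) ?_ ?_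
      · unfold Function.uncurry
        fun_prop
      · intro x y _ hy
        rw [image_eq_zero_of_notMem_tsupport hy, zero_mul]
    · refine HasCompactSupport.intro (hcs.isCompact.image continuous_snd) fun x hx => ?_
      have : ∀ y, a y * b (y⁻¹ * x) = 0 := fun y => by
        by_contra h
        exact hx ⟨(y, x), subset_tsupport _ h, rfl⟩
      simp [this]
  refine (L1.integrable_coeFn _).ae_eq_of_forall_setIntegral_eq _ _ hI fun s hs _ => ?_
  rw [conv, setIntegral_integral μ (integrable_conv μ A B),
    ← integral_integral_swap_of_hasCompactSupport hcont hcs (μ := μ) (ν := μ.restrict s)]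
  refine integral_congr_ae ?_
  filter_upwards [hA] with y hy
  refine integral_congr_ae (ae_restrict_of_ae ?_)
  have h2 := (measurePreserving_mul_left μ y⁻¹).quasiMeasurePreserving.ae_eq_comp hB
  filter_upwards [Lp.coeFn_smul (A y) (lTrans μ y B), lTrans_ae μ y B, h2] with x h3 h4 h5
  rw [h3, Pi.smul_apply, h4, smul_eq_mul, hy]
  exact congrArg (a y * ·) h5

theorem dense_compactSupport :
    Dense {A : Lp ℂ 1 μ | ∃ a : G → ℂ, Continuous a ∧ HasCompactSupport a ∧ A =ᵐ[μ] a} := by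
  intro f
  rw [EMetric.mem_closure_iff]
  intro ε hε
  obtain ⟨δ, hδ, hδε⟩ := exists_between hε
  obtain ⟨g, h2, h3, h1⟩ := exists_compactSupport_approx μ f hδ.ne'
  have h4 : MemLp g 1 μ := memLp_one_iff_integrable.2 (h3.integrable_of_hasCompactSupport h1)
  refine ⟨h4.toLp g, ⟨g, h3, h1, h4.coeFn_toLp⟩, ?_⟩
  rw [Lp.edist_def]
  refine lt_of_le_of_lt (le_trans (le_of_eq (eLpNorm_congr_ae ?_)) h2) hδε
  filter_upwards [h4.coeFn_toLp] with x hx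
  simp [hx]

theorem invol_add (f g : Lp ℂ 1 μ) : invol μ (f + g) = invol μ f + invol μ g := by
  refine Lp.ext ?_
  have h := (measurePreserving_inv' μ).quasiMeasurePreserving.ae_eq_comp (Lp.coeFn_add f g)
  filter_upwards [invol_ae μ (f + g), invol_ae μ f, invol_ae μ g,
    Lp.coeFn_add (invol μ f) (invol μ g), h] with x h1 h2 h3 h4 h5
  rw [h1, h4, Pi.add_apply, h2, h3, ← map_add]
  exact congrArg conj h5

theorem invol_smul (c : ℂ) (f : Lp ℂ 1 μ) : invol μ (c • f) = conj c • invol μ f := by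
  refine Lp.ext ?_
  have h := (measurePreserving_inv' μ).quasiMeasurePreserving.ae_eq_comp (Lp.coeFn_smul c f)
  filter_upwards [invol_ae μ (c • f), invol_ae μ f,
    Lp.coeFn_smul (conj c) (invol μ f), h] with x h1 h2 h4 h5
  rw [h1, h4, Pi.smul_apply, h2, smul_eq_mul, ← map_mul]
  exact congrArg conj h5

theorem invol_invol (f : Lp ℂ 1 μ) : invol μ (invol μ f) = f := by
  refine Lp.ext ?_
  have h := (measurePreserving_inv' μ).quasiMeasurePreserving.ae_eq_comp (invol_ae μ f)
  filter_upwards [invol_ae μ (invol μ f), h] with x h1 h2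
  rw [h1]
  refine (congrArg conj h2).trans ?_
  simp

theorem norm_invol (f : Lp ℂ 1 μ) : ‖invol μ f‖ = ‖f‖ := by
  rw [invol, Lp.norm_compMeasurePreserving, Lp.norm_def, Lp.norm_def]
  congr 1
  refine eLpNorm_congr_norm_ae ?_
  filter_upwards [Lp.coeFn_star f] with x hx
  rw [hx, Pi.star_apply, norm_star]

theorem continuous_invol : Continuous (invol μ) := by
  have hsub : ∀ f g, invol μ (f - g) = invol μ f - invol μ g := fun f g => by
    have := invol_add μ (f - g) g
    rw [sub_add_cancel] at this
    rw [this, add_sub_cancel_right]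
  refine (Isometry.of_dist_eq fun f g => ?_).continuous
  rw [dist_eq_norm, dist_eq_norm, ← hsub, norm_invol]

theorem invol_conv (f g : Lp ℂ 1 μ) :
    invol μ (conv μ f g) = conv μ (invol μ g) (invol μ f) := by
  have hc : Continuous fun p : Lp ℂ 1 μ × Lp ℂ 1 μ => conv μ p.1 p.2 :=
    (convL μ).continuous₂
  have hcl : IsClosed {p : Lp ℂ 1 μ × Lp ℂ 1 μ |
      invol μ (conv μ p.1 p.2) = conv μ (invol μ p.2) (invol μ p.1)} := by
    refine isClosed_eq ((continuous_invol μ).comp hc) ?_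
    exact hc.comp (((continuous_invol μ).comp continuous_snd).prodMk
      ((continuous_invol μ).comp continuous_fst))
  refine isClosed_property2
    (p := fun f g => invol μ (conv μ f g) = conv μ (invol μ g) (invol μ f)) (dense_compactSupport μ).denseRange_val hcl ?_ f g
  rintro ⟨A, a, ha, ha', hA⟩ ⟨B, b, hb, hb', hB⟩
  refine Lp.ext ?_
  have hq := (measurePreserving_inv' μ).quasiMeasurePreserving
  have hA2 : invol μ A =ᵐ[μ] fun x => conj (a x⁻¹) := by
    filter_upwards [invol_ae μ A, hq.ae_eq_comp hA] with x h1 h2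
    exact h1.trans (congrArg conj h2)
  have hB2 : invol μ B =ᵐ[μ] fun x => conj (b x⁻¹) := by
    filter_upwards [invol_ae μ B, hq.ae_eq_comp hB] with x h1 h2
    exact h1.trans (congrArg conj h2)
  have hconj : ∀ {c : G → ℂ}, HasCompactSupport c → HasCompactSupport fun x => conj (c x⁻¹) :=
    fun {c} h => (h.comp_homeomorph (Homeomorph.inv G)).comp_left (g := conj) (map_zero _)
  have h1 := conv_ae μ ha ha' hb hb' A B hA hB
  have h2 := conv_ae μ (a := fun x => conj (b x⁻¹)) (b := fun x => conj (a x⁻¹)) (by fun_prop)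
    (hconj hb') (by fun_prop) (hconj ha') _ _ hB2 hA2
  filter_upwards [invol_ae μ (conv μ A B), hq.ae_eq_comp h1, h2] with x h3 h4 h5
  rw [h3, h5]
  refine (congrArg conj h4).trans ?_
  simp only [Function.comp]
  rw [← integral_conj, ← integral_mul_left_eq_self (μ := μ) _ x⁻¹]
  refine integral_congr_ae (Eventually.of_forall fun y => ?_)
  simp [mul_comm]

noncomputable instance : NonUnitalNormedRing (L1 μ) where
  __ := L1.instNormedAddCommGroup μ
  mul := conv μ
  left_distrib := conv_add_right μ
  right_distrib := conv_add_left μ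
  zero_mul f := by
    have h := conv_smul_left μ 0 0 f
    rw [zero_smul, zero_smul] at h
    exact h
  mul_zero f := by
    have h := conv_smul_right μ 0 f 0
    rw [zero_smul, zero_smul] at h
    exact h
  mul_assoc := conv_assoc μ
  norm_mul_le := norm_conv_le μ

noncomputable instance : NormedSpace ℂ (L1 μ) := inferInstanceAs (NormedSpace ℂ (Lp ℂ 1 μ))

instance : CompleteSpace (L1 μ) := inferInstanceAs (CompleteSpace (Lp ℂ 1 μ))

noncomputable instance : StarRing (L1 μ) where
  star := invol μ
  star_involutive := invol_invol μ
  star_mul := invol_conv μ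
  star_add := invol_add μ

instance : NormedStarGroup (L1 μ) where
  norm_star_le f := (norm_invol μ f).le

instance : StarModule ℂ (L1 μ) where
  star_smul := invol_smul μ

instance : IsScalarTower ℂ (L1 μ) (L1 μ) where
  smul_assoc c f g := conv_smul_left μ c f g

instance : SMulCommClass ℂ (L1 μ) (L1 μ) where
  smul_comm c f g := (conv_smul_right μ c f g).symm

theorem lTrans_eq_iff (u : G) (f : Lp ℂ 1 μ) :
    lTrans μ u⁻¹ f = f ↔ (fun x => f (u * x)) =ᵐ[μ] f := by
  rw [Lp.ext_iff]
  have h := lTrans_ae μ u⁻¹ f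
  rw [inv_inv] at h
  exact ⟨fun h' => h.symm.trans h', fun h' => h.trans h'⟩

theorem rTrans_eq_iff (u : G) (f : Lp ℂ 1 μ) :
    rTrans μ u f = f ↔ (fun x => f (x * u)) =ᵐ[μ] f := by
  rw [Lp.ext_iff]
  have h := rTrans_ae μ u f
  exact ⟨fun h' => h.symm.trans h', fun h' => h.trans h'⟩

theorem invol_lTrans (y : G) (f : Lp ℂ 1 μ) : invol μ (lTrans μ y f) = rTrans μ y (invol μ f) := by
  refine Lp.ext ?_
  have h1 := (measurePreserving_inv' μ).quasiMeasurePreserving.ae_eq_comp (lTrans_ae μ y f)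
  have h2 := (measurePreserving_mul_right μ y).quasiMeasurePreserving.ae_eq_comp (invol_ae μ f)
  filter_upwards [invol_ae μ (lTrans μ y f), rTrans_ae μ y (invol μ f), h1, h2] with x h3 h4 h5 h6
  rw [h3, h4]
  refine (congrArg conj h5).trans (Eq.trans ?_ h6.symm)
  simp

/-- `L¹(U\G/U)`: the `*`-subalgebra of (classes of) `U`-biinvariant functions in `L¹(G)`. -/
noncomputable def biinvSubalgebra (U : Subgroup G) : NonUnitalStarSubalgebra ℂ (L1 μ) where
  carrier := {f | ∀ u ∈ U, (fun x => f.toLp (u * x)) =ᵐ[μ] f.toLp ∧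
    (fun x => f.toLp (x * u)) =ᵐ[μ] f.toLp}
  zero_mem' u _ := ⟨(lTrans_eq_iff μ u _).1 (map_zero _), (rTrans_eq_iff μ u _).1 (map_zero _)⟩
  add_mem' {f g} hf hg u hu := by
    refine ⟨(lTrans_eq_iff μ u _).1 ?_, (rTrans_eq_iff μ u _).1 ?_⟩
    · refine (map_add (lTrans μ u⁻¹) (f.toLp) (g.toLp)).trans ?_
      rw [(lTrans_eq_iff μ u _).2 (hf u hu).1, (lTrans_eq_iff μ u _).2 (hg u hu).1]
      rfl
    · refine (map_add (rTrans μ u) (f.toLp) (g.toLp)).trans ?_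
      rw [(rTrans_eq_iff μ u _).2 (hf u hu).2, (rTrans_eq_iff μ u _).2 (hg u hu).2]
      rfl
  mul_mem' {f g} hf hg u hu := by
    refine ⟨(lTrans_eq_iff μ u _).1 ?_, (rTrans_eq_iff μ u _).1 ?_⟩
    · refine (lTrans_conv μ u⁻¹ (f.toLp) (g.toLp)).trans ?_
      rw [(lTrans_eq_iff μ u _).2 (hf u hu).1]
      rfl
    · refine (rTrans_conv μ u (f.toLp) (g.toLp)).trans ?_
      rw [(rTrans_eq_iff μ u _).2 (hg u hu).2]
      rfl
  smul_mem' c f hf u hu := by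
    refine ⟨(lTrans_eq_iff μ u _).1 ?_, (rTrans_eq_iff μ u _).1 ?_⟩
    · refine (map_smul (lTrans μ u⁻¹) c (f.toLp)).trans ?_
      rw [(lTrans_eq_iff μ u _).2 (hf u hu).1]
      rfl
    · refine (map_smul (rTrans μ u) c (f.toLp)).trans ?_
      rw [(rTrans_eq_iff μ u _).2 (hf u hu).2]
      rfl
  star_mem' {f} hf u hu := by
    have hl : ∀ v ∈ U, lTrans μ v (f.toLp) = f.toLp := fun v hv => by
      have := (lTrans_eq_iff μ v⁻¹ _).2 (hf v⁻¹ (U.inv_mem hv)).1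
      rwa [inv_inv] at this
    have hr : ∀ v ∈ U, rTrans μ v (f.toLp) = f.toLp := fun v hv =>
      (rTrans_eq_iff μ v _).2 (hf v hv).2
    refine ⟨(lTrans_eq_iff μ u _).1 ?_, (rTrans_eq_iff μ u _).1 ?_⟩
    · change lTrans μ u⁻¹ (invol μ f.toLp) = invol μ f.toLp
      have h := invol_lTrans μ u⁻¹ (invol μ f.toLp)
      rw [invol_invol, hr _ (U.inv_mem hu)] at h
      have h' := congrArg (invol μ) h
      rwa [invol_invol] at h'
    · change rTrans μ u (invol μ f.toLp) = invol μ f.toLp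
      rw [← invol_lTrans, hl u hu]

theorem mem_biinvSubalgebra_iff (U : Subgroup G) (f : L1 μ) : f ∈ biinvSubalgebra μ U ↔
    ∀ u ∈ U, lTrans μ u (f.toLp) = f.toLp ∧ rTrans μ u (f.toLp) = f.toLp := by
  constructor
  · intro hf u hu
    have := (lTrans_eq_iff μ u⁻¹ _).2 (hf u⁻¹ (U.inv_mem hu)).1
    rw [inv_inv] at this
    exact ⟨this, (rTrans_eq_iff μ u _).2 (hf u hu).2⟩
  · intro hf u hu
    exact ⟨(lTrans_eq_iff μ u _).1 (hf u⁻¹ (U.inv_mem hu)).1, (rTrans_eq_iff μ u _).1 (hf u hu).2⟩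

theorem isClosed_biinvSubalgebra (U : Subgroup G) :
    IsClosed (biinvSubalgebra μ U : Set (L1 μ)) := by
  have : (biinvSubalgebra μ U : Set (L1 μ)) = ⋂ u ∈ U,
      {f : Lp ℂ 1 μ | lTrans μ u f = f} ∩ {f : Lp ℂ 1 μ | rTrans μ u f = f} := by
    ext f
    refine (mem_biinvSubalgebra_iff μ U f).trans ?_
    exact ⟨fun h => Set.mem_iInter₂.2 fun u hu => h u hu,
      fun h u hu => Set.mem_iInter₂.1 h u hu⟩
  rw [this]
  exact isClosed_biInter fun u _ => (isClosed_eq (lTrans μ u).continuous continuous_id).inter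
    (isClosed_eq (rTrans μ u).continuous continuous_id)

instance (U : Subgroup G) : CompleteSpace (biinvSubalgebra μ U) :=
  (isClosed_biinvSubalgebra μ U).completeSpace_coe

instance (U : Subgroup G) : NormedStarGroup (biinvSubalgebra μ U) where
  norm_star_le f := (norm_star (f : L1 μ)).le

/-- The element `p₀ = χ_U` of `L¹(G)`, for an open subgroup `U` with `μ(U) = 1`. -/
noncomputable def p0 (U : Subgroup G) (hU : IsOpen (U : Set G)) (hμ : μ U = 1) : L1 μ :=
  indicatorConstLp 1 hU.measurableSet (by rw [hμ]; exact ENNReal.one_ne_top) (1 : ℂ)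

variable (U : Subgroup G) (hU : IsOpen (U : Set G)) (hμ : μ U = 1)

theorem p0_ae : (p0 μ U hU hμ).toLp =ᵐ[μ] (U : Set G).indicator fun _ => (1 : ℂ) :=
  indicatorConstLp_coeFn (hs := hU.measurableSet) (hμs := by rw [hμ]; exact ENNReal.one_ne_top)

theorem p0_mem : p0 μ U hU hμ ∈ biinvSubalgebra μ U := by
  intro u hu
  have h := p0_ae μ U hU hμ
  refine ⟨?_, ?_⟩
  · refine ((measurePreserving_mul_left μ u).quasiMeasurePreserving.ae_eq_comp h).trans
      (EventuallyEq.trans (Eventually.of_forall fun x => ?_) h.symm)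
    by_cases hx : x ∈ U <;> simp [Set.indicator, U.mul_mem_cancel_left hu, hx]
  · refine ((measurePreserving_mul_right μ u).quasiMeasurePreserving.ae_eq_comp h).trans
      (EventuallyEq.trans (Eventually.of_forall fun x => ?_) h.symm)
    by_cases hx : x ∈ U <;> simp [Set.indicator, U.mul_mem_cancel_right hu, hx]

theorem star_p0 : star (p0 μ U hU hμ) = p0 μ U hU hμ := by
  refine Lp.ext ?_
  have h := p0_ae μ U hU hμ
  have h2 := (measurePreserving_inv' μ).quasiMeasurePreserving.ae_eq_comp h
  refine (invol_ae μ _).trans ?_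
  refine EventuallyEq.trans ?_ h.symm
  filter_upwards [h2] with x hx
  refine (congrArg conj hx).trans ?_
  by_cases hxU : x ∈ U <;> simp [Set.indicator, hxU]

theorem p0_mul {f : L1 μ} (hf : f ∈ biinvSubalgebra μ U) : p0 μ U hU hμ * f = f := by
  have hf' := (mem_biinvSubalgebra_iff μ U f).1 hf
  change (∫ y, (p0 μ U hU hμ).toLp y • lTrans μ y (f.toLp) ∂μ) = f.toLp
  have : (fun y => (p0 μ U hU hμ).toLp y • lTrans μ y (f.toLp)) =ᵐ[μ]
      (U : Set G).indicator fun _ => f.toLp := by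
    filter_upwards [p0_ae μ U hU hμ] with y hy
    rw [hy]
    by_cases hyU : y ∈ U
    · have hyU' : y ∈ (U : Set G) := hyU
      rw [Set.indicator_of_mem hyU', Set.indicator_of_mem hyU', one_smul, (hf' y hyU).1]
    · have hyU' : y ∉ (U : Set G) := hyU
      rw [Set.indicator_of_notMem hyU', Set.indicator_of_notMem hyU', zero_smul]
  rw [integral_congr_ae this, integral_indicator hU.measurableSet, setIntegral_const,
    measureReal_def, hμ, ENNReal.toReal_one, one_smul]

theorem mul_p0 {f : L1 μ} (hf : f ∈ biinvSubalgebra μ U) : f * p0 μ U hU hμ = f := by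
  have h := congrArg star (p0_mul μ U hU hμ (star_mem hf))
  rwa [star_mul, star_star, star_p0] at h

theorem isStarProjection_p0 : IsStarProjection (p0 μ U hU hμ) :=
  ⟨p0_mul μ U hU hμ (p0_mem μ U hU hμ), star_p0 μ U hU hμ⟩

/-- The projection `p₀` in the group `C^*`-algebra `C^*(G) = C^*(L¹(G))`. -/
noncomputable def cstarP0 : CStarEnv (L1 μ) := toCStarEnv (L1 μ) (p0 μ U hU hμ)

theorem isStarProjection_cstarP0 : IsStarProjection (cstarP0 μ U hU hμ) :=
  (isStarProjection_p0 μ U hU hμ).map (toCStarEnv (L1 μ))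

/-- The corner `p₀ C^*(G) p₀`. -/
noncomputable def cstarCorner : NonUnitalStarSubalgebra ℂ (CStarEnv (L1 μ)) :=
  corner (cstarP0 μ U hU hμ) (isStarProjection_cstarP0 μ U hU hμ)

/-- The `*`-homomorphism `C^*(L¹(U\G/U)) → C^*(L¹(G)) = C^*(G)` induced by the inclusion. -/
noncomputable def envIncl : CStarEnv (biinvSubalgebra μ U) →⋆ₙₐ[ℂ] CStarEnv (L1 μ) :=
  CStarEnv.map (NonUnitalStarSubalgebraClass.subtype (biinvSubalgebra μ U))

theorem envIncl_mem (x : CStarEnv (biinvSubalgebra μ U)) :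
    envIncl μ U x ∈ cstarCorner μ U hU hμ := by
  refine (mem_corner_iff _ (isStarProjection_cstarP0 μ U hU hμ) _).2 ?_
  have hc : Continuous (envIncl μ U) := CStarEnv.continuous_map _
  refine (denseRange_toCStarEnv (A := biinvSubalgebra μ U)).induction_on
    (p := fun x => cstarP0 μ U hU hμ * envIncl μ U x * cstarP0 μ U hU hμ = envIncl μ U x) x
    (isClosed_eq ((continuous_const.mul hc).mul continuous_const) hc) fun f => ?_
  have h : envIncl μ U (toCStarEnv (biinvSubalgebra μ U) f) = toCStarEnv (L1 μ) (f : L1 μ) :=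
    CStarEnv.map_toCStarEnv _ f
  rw [h, cstarP0, ← map_mul, ← map_mul, p0_mul μ U hU hμ f.2, mul_p0 μ U hU hμ f.2]

/-- The canonical map `Π : C^*(L¹(G, U)) → p₀ C^*(G) p₀`, where `L¹(G, U) = L¹(U\G/U)`: the
`*`-homomorphism with `Π(f) = f` for every `f ∈ L¹(U\G/U) = p₀ L¹(G) p₀`. -/
noncomputable def canonicalMap :
    CStarEnv (biinvSubalgebra μ U) →⋆ₙₐ[ℂ] cstarCorner μ U hU hμ :=
  NonUnitalStarAlgHom.codRestrict (envIncl μ U) (cstarCorner μ U hU hμ) (envIncl_mem μ U hU hμ)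

/-- `(G, U)` is a Gelfand pair: the algebra `L¹(U\G/U)` is commutative. -/
def IsGelfandPair : Prop := ∀ f ∈ biinvSubalgebra μ U, ∀ g ∈ biinvSubalgebra μ U, f * g = g * f

end GroupAlgebra

section Spherical

variable {G : Type u} [Group G] [TopologicalSpace G] [MeasurableSpace G]

/-- Spherical functions of `G` relative to `U`; the Haar measure `μ` is normalized by `μ(U) = 1`,
so that its restriction to `U` is the normalized Haar measure of `U`. -/
structure IsSpherical (μ : Measure G) (U : Subgroup G) (ω : G → ℂ) : Prop where
  continuous : Continuous ω
  map_one : ω 1 = 1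
  biinvariant : ∀ g, ∀ u₁ ∈ U, ∀ u₂ ∈ U, ω (u₁ * g * u₂) = ω g
  integral_eq : ∀ g₁ g₂, ∫ u in (U : Set G), ω (g₁ * u * g₂) ∂μ = ω g₁ * ω g₂

/-- `*`-spherical functions. -/
structure IsStarSpherical (μ : Measure G) (U : Subgroup G) (ω : G → ℂ) : Prop extends
    IsSpherical μ U ω where
  map_inv : ∀ g, ω g⁻¹ = conj (ω g)

/-- Positive definite functions on a group; the order on `ℂ` is such that `0 ≤ z` means that
`z` is real and nonnegative. -/
def IsPositiveDefinite (ω : G → ℂ) : Prop :=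
  ∀ (m : ℕ) (s : Fin m → G) (z : Fin m → ℂ),
    0 ≤ ∑ j, ∑ k, ω ((s j)⁻¹ * s k) * conj (z j) * z k

end Spherical

end GelfandPair

/-! Write `A = L¹(U\G/U)` and `δ_g` for left translation by `g`. The link between the two sides is
the correspondence between nonzero `*`-characters `χ` of `A` and bounded `*`-spherical functions
`ω`: `ω(g) = χ(p₀ δ_g p₀)` in one direction, `χ(f) = ∫ f ω` in the other. For `b = ∑ z_k δ_{s_k} p₀`
the element `b^* b` lies in `A`, and the associated functional takes on it the value `∑ conj(z_j)
z_k ω(s_j⁻¹ s_k)` (`star_sum_mul_sum_translate_p0`). So positive definiteness of `ω` says that `χ`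
is nonnegative on these `b^* b`, with `b` in `L¹(G) p₀` and not merely in `A`.

(a) implies (b). Since `A` is commutative, the norm of `C^*(A)` on `A` is governed by the
`*`-characters of `A`. If `ω` is positive definite, then `f ↦ χ(p₀ f p₀)` is a positive functional
on `L¹(G)`, because combinations of the `δ_g p₀` are dense in `L¹(G) p₀`. Its GNS representation is
a representation of `L¹(G)` in which `p₀` gives a unit vector, so `|χ(f)|` is at most the norm of
`f` in `C^*(G)` (`norm_character_le_norm_toCStarEnv_coe`). Hence `Π` is bounded below; its range is
then closed, and it contains the dense set of all `p₀ f p₀`, so `Π` is bijective.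

(b) implies (a). An injective `*`-homomorphism of `C^*`-algebras is isometric, so norms of elements
of `A` may be computed in `C^*(G)`. There `0 ≤ b^* b ≤ t p₀` with `t = ‖b‖²`, hence `‖t p₀ - b^* b‖
≤ t`. As `χ(p₀) = 1`, this gives `|t - χ(b^* b)| ≤ t`; since `χ(b^* b)` is real, it is nonnegative
(`character_nonneg_of_injective`). -/

namespace GelfandPair

/-! ### The GNS construction for a Banach `*`-algebra without unit. -/

section GNS

open scoped InnerProductSpace
open UniformSpace

variable {A : Type u} [NonUnitalNormedRing A] [StarRing A] [NormedSpace ℂ A]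
  [IsScalarTower ℂ A A] [SMulCommClass ℂ A A] [CompleteSpace A] [NormedStarGroup A]
  [StarModule ℂ A]

variable (A) in
/-- Bounded hermitian positive functionals on a Banach `*`-algebra. -/
structure PosFunctional where
  /-- The underlying bounded functional. -/
  toCLM : A →L[ℂ] ℂ
  map_star : ∀ a, toCLM (star a) = conj (toCLM a)
  nonneg : ∀ a, 0 ≤ toCLM (star a * a)

namespace PosFunctional

set_option linter.unusedVariables false in
/-- A type synonym of `A`, carrying the semi-inner product `⟪a, b⟫ = φ (a^* b)`. -/
def PreGNS (φ : PosFunctional A) : Type u := A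

variable (φ : PosFunctional A)

instance : AddCommGroup φ.PreGNS := inferInstanceAs (AddCommGroup A)
instance : Module ℂ φ.PreGNS := inferInstanceAs (Module ℂ A)

/-- The identity map from `A` to the pre-Hilbert space of a positive functional. -/
def toPreGNS : A ≃ₗ[ℂ] φ.PreGNS := LinearEquiv.refl ℂ _

/-- The identity map from the pre-Hilbert space of a positive functional to `A`. -/
def ofPreGNS : φ.PreGNS ≃ₗ[ℂ] A := φ.toPreGNS.symm

@[simp]
theorem ofPreGNS_toPreGNS (a : A) : φ.ofPreGNS (φ.toPreGNS a) = a := rfl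

/-- The semi-inner product `⟪a, b⟫ = φ (a^* b)`. -/
noncomputable abbrev preGNSCore : PreInnerProductSpace.Core ℂ φ.PreGNS where
  inner a b := φ.toCLM (star (φ.ofPreGNS a) * φ.ofPreGNS b)
  conj_inner_symm a b := by rw [← φ.map_star, star_mul, star_star]
  re_inner_nonneg a := (Complex.le_def.1 (φ.nonneg _)).1
  add_left _ _ _ := by rw [map_add, star_add, add_mul, map_add]
  smul_left _ _ _ := by
    rw [map_smul, star_smul, smul_mul_assoc, map_smul, smul_eq_mul]
    rfl

noncomputable instance : SeminormedAddCommGroup φ.PreGNS :=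
  InnerProductSpace.Core.toSeminormedAddCommGroup (c := φ.preGNSCore)
noncomputable instance : InnerProductSpace ℂ φ.PreGNS :=
  InnerProductSpace.ofCore φ.preGNSCore

theorem preGNS_inner_def (a b : φ.PreGNS) :
    ⟪a, b⟫_ℂ = φ.toCLM (star (φ.ofPreGNS a) * φ.ofPreGNS b) := rfl

theorem preGNS_norm_mul_self (a : φ.PreGNS) :
    ‖a‖ * ‖a‖ = (φ.toCLM (star (φ.ofPreGNS a) * φ.ofPreGNS a)).re :=
  (inner_self_eq_norm_mul_norm (𝕜 := ℂ) a).symm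

/-- Left multiplication on the pre-Hilbert space of a positive functional. -/
noncomputable def leftMul (a : A) : φ.PreGNS →ₗ[ℂ] φ.PreGNS :=
  φ.toPreGNS.toLinearMap ∘ₗ LinearMap.mul ℂ A a ∘ₗ φ.ofPreGNS.toLinearMap

theorem leftMul_apply (a : A) (x : φ.PreGNS) :
    φ.leftMul a x = φ.toPreGNS (a * φ.ofPreGNS x) := rfl

theorem leftMul_mul (a b : A) (x : φ.PreGNS) :
    φ.leftMul (a * b) x = φ.leftMul a (φ.leftMul b x) := by
  simp [leftMul_apply, mul_assoc]

theorem inner_leftMul (a : A) (x y : φ.PreGNS) :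
    ⟪φ.leftMul a x, y⟫_ℂ = ⟪x, φ.leftMul (star a) y⟫_ℂ := by
  simp [leftMul_apply, preGNS_inner_def, mul_assoc]

/-- Cauchy–Schwarz applied to `⟪x, a^* a x⟫`. Iterated, this one inequality gives the boundedness of
left multiplication. -/
theorem norm_leftMul_mul_self (a : A) (x : φ.PreGNS) :
    ‖φ.leftMul a x‖ * ‖φ.leftMul a x‖ ≤ ‖x‖ * ‖φ.leftMul (star a * a) x‖ := by
  rw [← inner_self_eq_norm_mul_norm (𝕜 := ℂ), inner_leftMul, ← leftMul_mul]
  exact (RCLike.re_le_norm _).trans (norm_inner_le_norm _ _)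

theorem preGNS_norm_le (x : φ.PreGNS) : ‖x‖ ≤ √‖φ.toCLM‖ * ‖φ.ofPreGNS x‖ := by
  refine abs_le_of_sq_le_sq' ?_ (by positivity) |>.2
  rw [mul_pow, Real.sq_sqrt (norm_nonneg _), sq, sq, preGNS_norm_mul_self]
  refine (Complex.re_le_norm _).trans ((φ.toCLM.le_opNorm _).trans ?_)
  gcongr
  simpa using norm_mul_le (star (φ.ofPreGNS x)) (φ.ofPreGNS x)

/-- Iterating `‖c x‖² ≤ ‖x‖ ‖c² x‖` reduces to `‖c^(2^n) x‖`, which continuity of `φ` bounds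
crudely. The constant in that bound does not depend on `n`, so it disappears on taking `2^n`-th
roots. The extra factor `‖x‖` on the left avoids the exponent `2^n - 1`. This replaces the usual
argument with a square root of `‖a‖² - a^* a`, which would need a unit. -/
theorem norm_leftMul_pow_le (x : φ.PreGNS) (n : ℕ) (c : A) (hc : IsSelfAdjoint c) :
    ‖φ.leftMul c x‖ ^ (2 ^ n) * ‖x‖ ≤
      √‖φ.toCLM‖ * ‖φ.ofPreGNS x‖ * (‖x‖ * ‖c‖) ^ (2 ^ n) := by
  induction n generalizing c with
  | zero =>
    have h := φ.preGNS_norm_le (φ.leftMul c x)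
    have h2 : ‖φ.ofPreGNS (φ.leftMul c x)‖ ≤ ‖c‖ * ‖φ.ofPreGNS x‖ := by
      rw [leftMul_apply, ofPreGNS_toPreGNS]
      exact norm_mul_le _ _
    rw [pow_zero, pow_one, pow_one]
    calc _ ≤ √‖φ.toCLM‖ * (‖c‖ * ‖φ.ofPreGNS x‖) * ‖x‖ := by gcongr; exact h.trans (by gcongr)
      _ = _ := by ring
  | succ n ih =>
    have h := φ.norm_leftMul_mul_self c x
    rw [hc.star_eq] at h
    have h2 := ih (c * c) (by rw [isSelfAdjoint_iff, star_mul, hc.star_eq])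
    calc ‖φ.leftMul c x‖ ^ (2 ^ (n + 1)) * ‖x‖
        = (‖φ.leftMul c x‖ * ‖φ.leftMul c x‖) ^ (2 ^ n) * ‖x‖ := by
          rw [pow_succ, mul_comm (2 ^ n), pow_mul, sq]
      _ ≤ (‖x‖ * ‖φ.leftMul (c * c) x‖) ^ (2 ^ n) * ‖x‖ := by gcongr
      _ = ‖x‖ ^ (2 ^ n) * (‖φ.leftMul (c * c) x‖ ^ (2 ^ n) * ‖x‖) := by ring
      _ ≤ ‖x‖ ^ (2 ^ n) * (√‖φ.toCLM‖ * ‖φ.ofPreGNS x‖ * (‖x‖ * ‖c * c‖) ^ (2 ^ n)) := by gcongr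
      _ ≤ ‖x‖ ^ (2 ^ n) * (√‖φ.toCLM‖ * ‖φ.ofPreGNS x‖ * (‖x‖ * (‖c‖ * ‖c‖)) ^ (2 ^ n)) := by
          gcongr
          exact norm_mul_le _ _
      _ = √‖φ.toCLM‖ * ‖φ.ofPreGNS x‖ * (‖x‖ * ‖c‖) ^ (2 ^ (n + 1)) := by
          rw [pow_succ, mul_comm (2 ^ n), pow_mul, sq, mul_mul_mul_comm, mul_pow, mul_pow, mul_pow,
            mul_pow]
          ring

theorem le_of_forall_pow_two_pow_mul_le {r s a K : ℝ} (hs : 0 ≤ s) (ha : 0 < a)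
    (h : ∀ n : ℕ, r ^ (2 ^ n) * a ≤ K * s ^ (2 ^ n)) : r ≤ s := by
  by_contra! hsr
  rcases hs.eq_or_lt with rfl | hs
  · have := h 0
    simp only [pow_zero, pow_one, mul_zero] at this
    nlinarith
  · have h1 : 1 < r / s := (one_lt_div hs).2 hsr
    have h2 : Tendsto (fun n : ℕ => (r / s) ^ (2 ^ n)) atTop atTop :=
      (tendsto_pow_atTop_atTop_of_one_lt h1).comp
        (tendsto_pow_atTop_atTop_of_one_lt one_lt_two)
    obtain ⟨n, hn⟩ := (h2.eventually_gt_atTop (K / a)).exists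
    rw [div_pow, div_lt_div_iff₀ ha (by positivity)] at hn
    exact absurd (h n) (not_le.2 hn)

theorem norm_leftMul_le_of_isSelfAdjoint (c : A) (hc : IsSelfAdjoint c) (x : φ.PreGNS) :
    ‖φ.leftMul c x‖ ≤ ‖x‖ * ‖c‖ := by
  rcases (norm_nonneg x).eq_or_lt with hx | hx
  -- The pairing is only semidefinite: null vectors cannot be cancelled, but Cauchy–Schwarz shows
  -- that `c` sends them to null vectors.
  · have h := φ.norm_leftMul_mul_self c x
    rw [← hx, zero_mul] at h ⊢
    nlinarith
  · exact le_of_forall_pow_two_pow_mul_le (by positivity) hx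
      fun n => φ.norm_leftMul_pow_le x n c hc

theorem norm_leftMul_le (a : A) (x : φ.PreGNS) : ‖φ.leftMul a x‖ ≤ ‖a‖ * ‖x‖ := by
  have h1 := φ.norm_leftMul_mul_self a x
  have h2 := φ.norm_leftMul_le_of_isSelfAdjoint (star a * a) (.star_mul_self a) x
  have h3 : ‖star a * a‖ ≤ ‖a‖ * ‖a‖ := by simpa using norm_mul_le (star a) a
  refine abs_le_of_sq_le_sq' ?_ (by positivity) |>.2
  calc ‖φ.leftMul a x‖ ^ 2 ≤ ‖x‖ * ‖φ.leftMul (star a * a) x‖ := by rwa [sq]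
    _ ≤ ‖x‖ * (‖x‖ * (‖a‖ * ‖a‖)) := by
      gcongr
      exact h2.trans (by gcongr)
    _ = (‖a‖ * ‖x‖) ^ 2 := by ring

/-- Left multiplication as a bounded operator. -/
noncomputable def leftMulL (a : A) : φ.PreGNS →L[ℂ] φ.PreGNS :=
  (φ.leftMul a).mkContinuous ‖a‖ (φ.norm_leftMul_le a)

theorem leftMulL_apply (a : A) (x : φ.PreGNS) :
    φ.leftMulL a x = φ.toPreGNS (a * φ.ofPreGNS x) := rfl

theorem completion_leftMulL_coe (a : A) (x : φ.PreGNS) :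
    (φ.leftMulL a).completion (x : Completion φ.PreGNS) = (φ.leftMulL a x : φ.PreGNS) := by
  simp

theorem completion_clm_ext {S T : Completion φ.PreGNS →L[ℂ] Completion φ.PreGNS}
    (h : ∀ x : φ.PreGNS, S x = T x) : S = T := by
  ext c
  induction c using Completion.induction_on with
  | hp => exact isClosed_eq S.continuous T.continuous
  | ih c => exact h c

/-- The Gelfand–Naimark–Segal representation of a Banach `*`-algebra attached to a bounded
positive functional. -/
noncomputable def gns : StarRep A where
  H := Completion φ.PreGNS
  toHom :=
    { toFun := fun a => (φ.leftMulL a).completion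
      map_smul' := fun c a => φ.completion_clm_ext fun x => by
        simp [leftMulL_apply, smul_mul_assoc, Completion.coe_smul]
      map_zero' := φ.completion_clm_ext fun x => by
        simp [leftMulL_apply, Completion.coe_zero]
      map_add' := fun a b => φ.completion_clm_ext fun x => by
        simp [leftMulL_apply, add_mul, Completion.coe_add]
      map_mul' := fun a b => φ.completion_clm_ext fun x => by
        simp [leftMulL_apply, mul_assoc]
      map_star' := fun a => by
        refine (ContinuousLinearMap.eq_adjoint_iff _ _).2 fun x y => ?_
        induction x, y using Completion.induction_on₂ with
        | hp => apply isClosed_eq <;> fun_prop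
        | ih x y =>
          rw [completion_leftMulL_coe, completion_leftMulL_coe, Completion.inner_coe,
            Completion.inner_coe]
          simp [leftMulL_apply, preGNS_inner_def, mul_assoc] }

/-- `φ(e^* a e)` is the matrix coefficient of `a` at the vector given by `e`. Without a unit there
is no canonical cyclic vector; later `e = p₀` takes that role. -/
theorem norm_apply_le_gns (e a : A) :
    ‖φ.toCLM (star e * a * e)‖ ≤ ‖φ.gns.toHom a‖ * (φ.toCLM (star e * e)).re := by
  let ξ : Completion φ.PreGNS := (φ.toPreGNS e : φ.PreGNS)
  have h1 : ‖ξ‖ * ‖ξ‖ = (φ.toCLM (star e * e)).re := by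
    rw [Completion.norm_coe, preGNS_norm_mul_self, ofPreGNS_toPreGNS]
  have h2 : ⟪ξ, (φ.leftMulL a).completion ξ⟫_ℂ = φ.toCLM (star e * a * e) := by
    rw [completion_leftMulL_coe, Completion.inner_coe, preGNS_inner_def, leftMulL_apply,
      ofPreGNS_toPreGNS, ofPreGNS_toPreGNS, mul_assoc]
  rw [← h2, ← h1]
  calc _ ≤ ‖ξ‖ * ‖(φ.leftMulL a).completion ξ‖ := norm_inner_le_norm _ _
    _ ≤ ‖ξ‖ * (‖(φ.leftMulL a).completion‖ * ‖ξ‖) := by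
      gcongr
      exact ContinuousLinearMap.le_opNorm _ _
    _ = ‖φ.gns.toHom a‖ * (‖ξ‖ * ‖ξ‖) := by
      change _ = ‖(φ.leftMulL a).completion‖ * _
      ring

end PosFunctional

end GNS

end GelfandPair

namespace GelfandPair

/-! ### The enveloping norm and `*`-characters. -/

section Envelope

open WeakDual

variable {A : Type u} [NonUnitalNormedRing A] [StarRing A] [NormedSpace ℂ A]
  [IsScalarTower ℂ A A] [SMulCommClass ℂ A A] [CompleteSpace A] [NormedStarGroup A]

theorem norm_toCStarEnv_le {a : A} {c : ℝ} (hc : 0 ≤ c) (h : ∀ ρ : StarRep A, ‖ρ.toHom a‖ ≤ c) :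
    ‖toCStarEnv A a‖ ≤ c :=
  RepProd.norm_le (x := universalRep A a) hc h

theorem StarRep.norm_le_norm_toCStarEnv (ρ : StarRep A) (a : A) :
    ‖ρ.toHom a‖ ≤ ‖toCStarEnv A a‖ :=
  RepProd.norm_eval_le (universalRep A a) ρ

/-- A `*`-character as a one-dimensional `*`-representation. -/
noncomputable def characterRep (χ : A →⋆ₙₐ[ℂ] ℂ) : StarRep A where
  -- A copy of `ℂ` in the universe that `StarRep` prescribes.
  H := EuclideanSpace ℂ PUnit.{u + 1}
  toHom :=
    { toFun := fun a => χ a • ContinuousLinearMap.id ℂ _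
      map_smul' := fun c a => by simp [mul_smul]
      map_zero' := by simp
      map_add' := fun a b => by
        ext
        simp [add_mul]
      map_mul' := fun a b => by
        ext
        simp [mul_assoc, mul_left_comm]
      map_star' := fun a => by
        rw [map_star, star_smul]
        congr 1
        exact (star_one (EuclideanSpace ℂ PUnit.{u + 1} →L[ℂ] EuclideanSpace ℂ PUnit.{u + 1})).symm }

theorem norm_characterRep (χ : A →⋆ₙₐ[ℂ] ℂ) (a : A) : ‖(characterRep χ).toHom a‖ = ‖χ a‖ := by
  change ‖χ a • ContinuousLinearMap.id ℂ (EuclideanSpace ℂ PUnit.{u + 1})‖ = _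
  rw [norm_smul, ContinuousLinearMap.norm_id, mul_one]

theorem norm_character_le (χ : A →⋆ₙₐ[ℂ] ℂ) (a : A) : ‖χ a‖ ≤ ‖a‖ := by
  rw [← norm_characterRep]
  exact (characterRep χ).norm_le a

theorem norm_character_le_norm_toCStarEnv (χ : A →⋆ₙₐ[ℂ] ℂ) (a : A) :
    ‖χ a‖ ≤ ‖toCStarEnv A a‖ := by
  rw [← norm_characterRep]
  exact (characterRep χ).norm_le_norm_toCStarEnv a

/-- In a commutative `C^*`-algebra the norm is determined by the `*`-characters. -/
theorem norm_le_of_forall_character {C : Type*} [NonUnitalCommCStarAlgebra C] {x : C} {c : ℝ}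
    (hc : 0 ≤ c) (h : ∀ χ : C →⋆ₙₐ[ℂ] ℂ, ‖χ x‖ ≤ c) : ‖x‖ ≤ c := by
  -- The Gelfand transform of the unitization is isometric. Its characters preserve `star`
  -- automatically and restrict to `*`-characters of `C`; one of the restrictions is zero, which
  -- does no harm to an upper bound.
  rw [← Unitization.norm_inr (𝕜 := ℂ) x,
    ← (gelfandTransform_isometry (Unitization ℂ C)).norm_map_of_map_zero (map_zero _),
    ContinuousMap.norm_le _ hc]
  intro χ
  let ψ : Unitization ℂ C →⋆ₙₐ[ℂ] ℂ :=
    { toFun := χ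
      map_smul' := fun c a => map_smul χ c a
      map_zero' := map_zero χ
      map_add' := map_add χ
      map_mul' := map_mul χ
      map_star' := map_star χ }
  exact h (ψ.comp (Unitization.inrNonUnitalStarAlgHom ℂ C))

theorem toCStarEnv_mul_comm (hA : ∀ a b : A, a * b = b * a) (x y : CStarEnv A) :
    x * y = y * x := by
  refine isClosed_property2 (p := fun x y : CStarEnv A => x * y = y * x) denseRange_toCStarEnv
    (isClosed_eq continuous_mul (continuous_snd.mul continuous_fst)) (fun a b => ?_) x y
  rw [← map_mul, hA, map_mul]

theorem norm_toCStarEnv_le_of_forall_character (hA : ∀ a b : A, a * b = b * a) {a : A} {c : ℝ}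
    (hc : 0 ≤ c) (h : ∀ χ : A →⋆ₙₐ[ℂ] ℂ, ‖χ a‖ ≤ c) : ‖toCStarEnv A a‖ ≤ c := by
  let _ : NonUnitalCommCStarAlgebra (CStarEnv A) :=
    { (inferInstance : NonUnitalCStarAlgebra (CStarEnv A)) with
      mul_comm := toCStarEnv_mul_comm hA }
  exact norm_le_of_forall_character (C := CStarEnv A) hc fun χ => h (χ.comp (toCStarEnv A))

end Envelope

/-! ### An operator inequality in the corner of a projection. -/

section Positivity

variable {H : Type*} [NormedAddCommGroup H] [InnerProductSpace ℂ H] [CompleteSpace H]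

/-- From `0 ≤ S^* S ≤ t` one gets `0 ≤ t - S^* S ≤ t`, hence the bound with `1` in place of `P`.
Compressing by `P` fixes `S^* S`, turns `t` into `t P`, and does not increase the norm. -/
theorem norm_smul_sub_star_mul_self_le {P S : H →L[ℂ] H} (hP : IsStarProjection P)
    (hS : S * P = S) {t : ℝ} (ht : ‖S‖ * ‖S‖ ≤ t) : ‖t • P - star S * S‖ ≤ t := by
  have ht0 : 0 ≤ t := (mul_nonneg (norm_nonneg _) (norm_nonneg _)).trans ht
  have h1 : star S * S ≤ algebraMap ℝ _ t := by
    rw [← CStarAlgebra.norm_le_iff_le_algebraMap _ ht0 (star_mul_self_nonneg S),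
      CStarRing.norm_star_mul_self]
    exact ht
  have h2 : ‖algebraMap ℝ (H →L[ℂ] H) t - star S * S‖ ≤ t := by
    rw [CStarAlgebra.norm_le_iff_le_algebraMap _ ht0 (sub_nonneg.2 h1)]
    exact sub_le_self _ (star_mul_self_nonneg S)
  have h3 : P * star S = star S := by
    conv_rhs => rw [← hS, star_mul, hP.isSelfAdjoint.star_eq]
  have h4 : t • P - star S * S = P * (algebraMap ℝ (H →L[ℂ] H) t - star S * S) * P := by
    rw [mul_sub, sub_mul, ← mul_assoc P, h3, mul_assoc (star S), hS,
      Algebra.algebraMap_eq_smul_one, mul_smul_comm, mul_one, smul_mul_assoc,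
      hP.isIdempotentElem.eq]
  rw [h4]
  have hP1 : ‖P‖ ≤ 1 := hP.norm_le
  calc _ ≤ ‖P‖ * ‖algebraMap ℝ (H →L[ℂ] H) t - star S * S‖ * ‖P‖ :=
        (norm_mul_le _ _).trans (by gcongr; exact norm_mul_le _ _)
    _ ≤ 1 * t * 1 := by gcongr
    _ = t := by ring

end Positivity

end GelfandPair

namespace GelfandPair

/-! ### Translations and the projection `p₀` in `L¹(G)`. -/

section Translation

variable {G : Type u} [Group G] [TopologicalSpace G] [IsTopologicalGroup G]
  [LocallyCompactSpace G] [MeasurableSpace G] [BorelSpace G]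
variable (μ : Measure G) [μ.IsHaarMeasure] [μ.Regular] [μ.IsMulRightInvariant]

/-- Left translation `(translate μ y f) x = f (y⁻¹ * x)` as an operator on the group algebra. -/
noncomputable def translate (y : G) : L1 μ →L[ℂ] L1 μ := (lTrans μ y).toContinuousLinearMap

theorem norm_translate (y : G) (f : L1 μ) : ‖translate μ y f‖ = ‖f‖ :=
  (lTrans μ y).norm_map f.toLp

theorem continuous_translate (f : L1 μ) : Continuous fun y => translate μ y f :=
  continuous_lTrans μ f.toLp

theorem translate_one (f : L1 μ) : translate μ 1 f = f := by
  refine Lp.ext ((lTrans_ae μ 1 f.toLp).trans (Eventually.of_forall fun x => ?_))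
  simp only [inv_one, one_mul]
  rfl

theorem translate_mul (y z : G) (f : L1 μ) :
    translate μ (y * z) f = translate μ y (translate μ z f) := lTrans_mul μ y z f.toLp

theorem translate_mul_left (y : G) (f g : L1 μ) :
    translate μ y (f * g) = translate μ y f * g := lTrans_conv μ y f.toLp g.toLp

theorem integrable_smul_translate (f g : L1 μ) :
    Integrable (fun y => f.toLp y • translate μ y g) μ := integrable_conv μ f.toLp g.toLp

theorem mul_eq_integral (f g : L1 μ) : f * g = ∫ y, f.toLp y • translate μ y g ∂μ := rfl

/-- A product is a Bochner integral of translates, and bounded operators pass under the integral.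
Identities for `L (f * g)` are thereby reduced to translates of `g`, with no appeal to Fubini for
functions. -/
theorem clm_mul_eq_integral {E : Type*} [NormedAddCommGroup E] [NormedSpace ℂ E] [CompleteSpace E]
    (L : L1 μ →L[ℂ] E) (f g : L1 μ) : L (f * g) = ∫ y, f.toLp y • L (translate μ y g) ∂μ := by
  rw [mul_eq_integral, ← L.integral_comp_comm (integrable_smul_translate μ f g)]
  simp only [map_smul]

/-- This is `(δ_y f)^* g = f^* δ_{y⁻¹} g`, with translations standing in for point masses, which
need not lie in `L¹(G)`. It is a change of variable by a right translation, so it rests on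
unimodularity. -/
theorem star_translate_mul (y : G) (f g : L1 μ) :
    star (translate μ y f) * g = star f * translate μ y⁻¹ g := by
  have h : star (translate μ y f) = rTrans μ y (invol μ f.toLp) := invol_lTrans μ y f.toLp
  rw [mul_eq_integral, mul_eq_integral,
    ← integral_mul_right_eq_self (fun z => (star f).toLp z • translate μ z (translate μ y⁻¹ g)) y]
  refine integral_congr_ae ?_
  filter_upwards [rTrans_ae μ y (invol μ f.toLp)] with z hz
  rw [← translate_mul, mul_inv_cancel_right, h]
  exact congrArg (· • translate μ z g) hz

variable (U : Subgroup G) (hU : IsOpen (U : Set G)) (hμ : μ U = 1)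

theorem p0_smul_ae (F : G → L1 μ) : (fun y => (p0 μ U hU hμ).toLp y • F y) =ᵐ[μ]
    (U : Set G).indicator F := by
  filter_upwards [p0_ae μ U hU hμ] with y hy
  rw [hy]
  by_cases hyU : y ∈ (U : Set G) <;> simp [hyU]

theorem integrableOn_translate (hU : IsOpen (U : Set G)) (hμ : μ U = 1) (f : L1 μ) :
    IntegrableOn (fun u => translate μ u f) (U : Set G) μ := by
  rw [← integrable_indicator_iff hU.measurableSet]
  exact (integrable_smul_translate μ (p0 μ U hU hμ) f).congr (p0_smul_ae μ U hU hμ _)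

/-- As a measure, `p₀` is the normalized Haar measure of `U`. This turns the average over `U` in the
functional equation of spherical functions into a product with `p₀`. -/
theorem p0_mul_eq_setIntegral (f : L1 μ) :
    p0 μ U hU hμ * f = ∫ u in (U : Set G), translate μ u f ∂μ := by
  rw [mul_eq_integral, integral_congr_ae (p0_smul_ae μ U hU hμ _),
    integral_indicator hU.measurableSet]

theorem clm_p0_mul_eq_setIntegral (L : L1 μ →L[ℂ] ℂ) (f : L1 μ) :
    L (p0 μ U hU hμ * f) = ∫ u in (U : Set G), L (translate μ u f) ∂μ := by
  rw [p0_mul_eq_setIntegral, ← L.integral_comp_comm (integrableOn_translate μ U hU hμ f)]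

theorem translate_p0 {u : G} (hu : u ∈ U) : translate μ u (p0 μ U hU hμ) = p0 μ U hU hμ :=
  ((mem_biinvSubalgebra_iff μ U _).1 (p0_mem μ U hU hμ) u hu).1

theorem p0_mul_translate {u : G} (hu : u ∈ U) (f : L1 μ) :
    p0 μ U hU hμ * translate μ u f = p0 μ U hU hμ * f := by
  have h := star_translate_mul μ u⁻¹ (p0 μ U hU hμ) f
  rw [translate_p0 μ U hU hμ (U.inv_mem hu), inv_inv, star_p0] at h
  exact h.symm

theorem p0_mul_p0 : p0 μ U hU hμ * p0 μ U hU hμ = p0 μ U hU hμ :=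
  (isStarProjection_p0 μ U hU hμ).isIdempotentElem

theorem translate_p0_mul_p0 (g : G) :
    translate μ g (p0 μ U hU hμ) * p0 μ U hU hμ = translate μ g (p0 μ U hU hμ) := by
  rw [← translate_mul_left, p0_mul_p0]

theorem mem_biinvSubalgebra_of_p0_mul {f : L1 μ} (h₁ : p0 μ U hU hμ * f = f)
    (h₂ : f * p0 μ U hU hμ = f) : f ∈ biinvSubalgebra μ U := by
  have key : ∀ k : L1 μ, p0 μ U hU hμ * k = k → ∀ u ∈ U, translate μ u k = k := by
    intro k hk u hu
    rw [← hk, translate_mul_left, translate_p0 μ U hU hμ hu]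
  rw [mem_biinvSubalgebra_iff]
  refine fun u hu => ⟨key f h₁ u hu, ?_⟩
  -- Right invariance of `f` is left invariance of `f^*`, and `p₀ f^* = f^*`.
  have h3 : translate μ u (star f) = star f :=
    key _ (by conv_rhs => rw [← h₂, star_mul, star_p0]) u hu
  have h4 : star (translate μ u (star f)) = rTrans μ u (invol μ (invol μ f.toLp)) :=
    invol_lTrans μ u (star f).toLp
  rw [h3, star_star, invol_invol] at h4
  exact h4.symm

theorem p0_mul_mul_p0_mem (f : L1 μ) : p0 μ U hU hμ * f * p0 μ U hU hμ ∈ biinvSubalgebra μ U := by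
  refine mem_biinvSubalgebra_of_p0_mul μ U hU hμ ?_ ?_
  · rw [← mul_assoc, ← mul_assoc, p0_mul_p0]
  · rw [mul_assoc, p0_mul_p0]

theorem star_translate_p0_mul_translate_p0 (g h : G) :
    star (translate μ g (p0 μ U hU hμ)) * translate μ h (p0 μ U hU hμ) =
      p0 μ U hU hμ * translate μ (g⁻¹ * h) (p0 μ U hU hμ) := by
  rw [star_translate_mul, star_p0, translate_mul]

/-- Applying the functional of a spherical function turns the right-hand side into the sum in the
definition of positive definiteness. Both implications use this identity. -/
theorem star_sum_mul_sum_translate_p0 {m : ℕ} (s : Fin m → G) (z : Fin m → ℂ) :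
    star (∑ j, z j • translate μ (s j) (p0 μ U hU hμ)) *
        ∑ k, z k • translate μ (s k) (p0 μ U hU hμ) =
      ∑ j, ∑ k, (conj (z j) * z k) • (p0 μ U hU hμ *
        translate μ ((s j)⁻¹ * s k) (p0 μ U hU hμ)) := by
  rw [star_sum, Finset.sum_mul_sum]
  refine Finset.sum_congr rfl fun j _ => Finset.sum_congr rfl fun k _ => ?_
  rw [star_smul, smul_mul_smul_comm, star_translate_p0_mul_translate_p0]
  rfl

/-- Right multiplication by `p₀` maps into the closed span of the translates of `p₀`. -/
theorem mul_p0_mem_closure (f : L1 μ) : f * p0 μ U hU hμ ∈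
    (Submodule.span ℂ (Set.range fun y => translate μ y (p0 μ U hU hμ))).topologicalClosure := by
  set S := (Submodule.span ℂ (Set.range fun y =>
    translate μ y (p0 μ U hU hμ))).topologicalClosure with hS
  have hcl : IsClosed (S : Set (L1 μ)) := Submodule.isClosed_topologicalClosure _
  -- Modulo the closed subspace `S` every translate of `p₀` vanishes, so the integral representing
  -- `f * p₀` vanishes too.
  have h := clm_mul_eq_integral μ S.mkQL f (p0 μ U hU hμ)
  have h0 : ∀ y, S.mkQL (translate μ y (p0 μ U hU hμ)) = 0 := fun y =>
    (Submodule.Quotient.mk_eq_zero S).2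
      (Submodule.le_topologicalClosure _ (Submodule.subset_span ⟨y, rfl⟩))
  simp only [h0, smul_zero, integral_zero] at h
  exact (Submodule.Quotient.mk_eq_zero S).1 h

end Translation

end GelfandPair

namespace GelfandPair

/-! ### From `*`-characters to spherical functions and representations of `L¹(G)`. -/

section CharacterToSpherical

variable {G : Type u} [Group G] [TopologicalSpace G] [IsTopologicalGroup G]
  [LocallyCompactSpace G] [MeasurableSpace G] [BorelSpace G]
variable (μ : Measure G) [μ.IsHaarMeasure] [μ.Regular] [μ.IsMulRightInvariant]
variable (U : Subgroup G) (hU : IsOpen (U : Set G)) (hμ : μ U = 1)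

/-- The compression `f ↦ p₀ f p₀` of `L¹(G)` onto `L¹(U\G/U)`. -/
noncomputable def compress (f : L1 μ) : biinvSubalgebra μ U :=
  ⟨p0 μ U hU hμ * f * p0 μ U hU hμ, p0_mul_mul_p0_mem μ U hU hμ f⟩

theorem coe_compress (f : L1 μ) :
    (compress μ U hU hμ f : L1 μ) = p0 μ U hU hμ * f * p0 μ U hU hμ := rfl

theorem norm_p0_le : ‖p0 μ U hU hμ‖ ≤ 1 := by
  have h : ‖p0 μ U hU hμ‖ = ‖(1 : ℂ)‖ * μ.real U ^ (1 / (1 : ℝ≥0∞).toReal) :=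
    norm_indicatorConstLp one_ne_zero ENNReal.one_ne_top
  rw [h, measureReal_def, hμ]
  simp

theorem norm_compress_le (f : L1 μ) : ‖compress μ U hU hμ f‖ ≤ ‖f‖ := by
  have h := norm_p0_le μ U hU hμ
  calc ‖p0 μ U hU hμ * f * p0 μ U hU hμ‖ ≤ ‖p0 μ U hU hμ‖ * ‖f‖ * ‖p0 μ U hU hμ‖ :=
        (norm_mul_le _ _).trans (by gcongr; exact norm_mul_le _ _)
    _ ≤ 1 * ‖f‖ * 1 := by gcongr
    _ = ‖f‖ := by ring

theorem compress_coe (f : biinvSubalgebra μ U) : compress μ U hU hμ f = f :=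
  Subtype.ext (by rw [coe_compress, p0_mul μ U hU hμ f.2, mul_p0 μ U hU hμ f.2])

theorem compress_star (f : L1 μ) : compress μ U hU hμ (star f) = star (compress μ U hU hμ f) :=
  Subtype.ext (by
    rw [StarMemClass.coe_star, coe_compress, coe_compress, star_mul, star_mul, star_p0,
      mul_assoc])

theorem compress_p0_mul (f : L1 μ) :
    compress μ U hU hμ (p0 μ U hU hμ * f) = compress μ U hU hμ f :=
  Subtype.ext (by rw [coe_compress, coe_compress, ← mul_assoc, p0_mul_p0])

theorem compress_mul_p0 (f : L1 μ) :
    compress μ U hU hμ (f * p0 μ U hU hμ) = compress μ U hU hμ f :=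
  Subtype.ext (by
    rw [coe_compress, coe_compress, ← mul_assoc, mul_assoc _ (p0 μ U hU hμ), p0_mul_p0])

/-- Compression is not multiplicative in general; a factor `p₀` between `f` and `g` makes it so,
because `p₀` is idempotent. -/
theorem compress_mul_p0_mul (f g : L1 μ) : compress μ U hU hμ (f * (p0 μ U hU hμ * g)) =
    compress μ U hU hμ f * compress μ U hU hμ g :=
  Subtype.ext (by
    rw [MulMemClass.coe_mul, coe_compress, coe_compress, coe_compress]
    -- This doubles all three factors `p₀`. Only the middle doubling is wanted; the outer two are
    -- contracted again at the end.
    conv_lhs => rw [← p0_mul_p0 μ U hU hμ]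
    simp only [mul_assoc]
    rw [← mul_assoc (p0 μ U hU hμ) (p0 μ U hU hμ) (f * _), p0_mul_p0])

/-- The functional `f ↦ χ (p₀ f p₀)` on `L¹(G)` attached to a `*`-character of `L¹(U\G/U)`. -/
noncomputable def characterFunctional (χ : biinvSubalgebra μ U →⋆ₙₐ[ℂ] ℂ) : L1 μ →L[ℂ] ℂ :=
  LinearMap.mkContinuous
    { toFun := fun f => χ (compress μ U hU hμ f)
      map_add' := fun f g => by
        rw [← map_add]
        congr 1
        exact Subtype.ext (by simp [coe_compress, mul_add, add_mul])
      map_smul' := fun c f => by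
        rw [RingHom.id_apply, ← map_smul]
        congr 1
        exact Subtype.ext (by simp [coe_compress, mul_smul_comm, smul_mul_assoc]) } 1
    fun f => by
      rw [one_mul]
      exact (norm_character_le χ _).trans (norm_compress_le μ U hU hμ f)

variable (χ : biinvSubalgebra μ U →⋆ₙₐ[ℂ] ℂ)

theorem characterFunctional_apply (f : L1 μ) :
    characterFunctional μ U hU hμ χ f = χ (compress μ U hU hμ f) := rfl

theorem characterFunctional_coe (f : biinvSubalgebra μ U) :
    characterFunctional μ U hU hμ χ f = χ f := by
  rw [characterFunctional_apply, compress_coe]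

theorem characterFunctional_star (f : L1 μ) :
    characterFunctional μ U hU hμ χ (star f) = conj (characterFunctional μ U hU hμ χ f) := by
  rw [characterFunctional_apply, compress_star, map_star]
  rfl

theorem characterFunctional_p0_mul (f : L1 μ) :
    characterFunctional μ U hU hμ χ (p0 μ U hU hμ * f) = characterFunctional μ U hU hμ χ f := by
  rw [characterFunctional_apply, compress_p0_mul, characterFunctional_apply]

theorem characterFunctional_mul_p0 (f : L1 μ) :
    characterFunctional μ U hU hμ χ (f * p0 μ U hU hμ) = characterFunctional μ U hU hμ χ f := by
  rw [characterFunctional_apply, compress_mul_p0, characterFunctional_apply]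

theorem characterFunctional_mul_p0_mul (f g : L1 μ) :
    characterFunctional μ U hU hμ χ (f * (p0 μ U hU hμ * g)) =
      characterFunctional μ U hU hμ χ f * characterFunctional μ U hU hμ χ g := by
  rw [characterFunctional_apply, compress_mul_p0_mul, map_mul]
  rfl

theorem characterFunctional_translate {u : G} (hu : u ∈ U) (f : L1 μ) :
    characterFunctional μ U hU hμ χ (translate μ u f) = characterFunctional μ U hU hμ χ f := by
  rw [← characterFunctional_p0_mul, p0_mul_translate μ U hU hμ hu, characterFunctional_p0_mul]

/-- `p₀` is the unit of `L¹(U\G/U)`, so a nonzero character takes the value `1` there. The zero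
character has to be excluded since `ω(e) = 1` is required. -/
theorem characterFunctional_p0 {f : biinvSubalgebra μ U} (hf : χ f ≠ 0) :
    characterFunctional μ U hU hμ χ (p0 μ U hU hμ) = 1 := by
  have h := characterFunctional_mul_p0_mul μ U hU hμ χ (p0 μ U hU hμ) (f : L1 μ)
  rw [characterFunctional_p0_mul, characterFunctional_p0_mul, characterFunctional_coe] at h
  exact (mul_eq_right₀ hf).1 h.symm

/-- The spherical function `g ↦ χ (p₀ δ_g p₀)` of a `*`-character of `L¹(U\G/U)`. -/
noncomputable def characterSpherical (g : G) : ℂ :=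
  characterFunctional μ U hU hμ χ (translate μ g (p0 μ U hU hμ))

theorem isStarSpherical_characterSpherical
    (hχ : characterFunctional μ U hU hμ χ (p0 μ U hU hμ) = 1) :
    IsStarSpherical μ U (characterSpherical μ U hU hμ χ) where
  continuous := (characterFunctional μ U hU hμ χ).continuous.comp (continuous_translate μ _)
  map_one := by rw [characterSpherical, translate_one, hχ]
  biinvariant g u₁ hu₁ u₂ hu₂ := by
    rw [characterSpherical, mul_assoc, translate_mul, translate_mul, translate_p0 μ U hU hμ hu₂,
      characterFunctional_translate μ U hU hμ χ hu₁, characterSpherical]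
  integral_eq g₁ g₂ := by
    -- The integral over `U` is the functional at `δ_{g₁} p₀ δ_{g₂} p₀`. Rewriting this as `(δ_{g₁}
    -- p₀) p₀ (δ_{g₂} p₀)` lets multiplicativity across `p₀` split it.
    have h := clm_p0_mul_eq_setIntegral μ U hU hμ
      ((characterFunctional μ U hU hμ χ).comp (translate μ g₁)) (translate μ g₂ (p0 μ U hU hμ))
    simp only [ContinuousLinearMap.comp_apply, ← translate_mul] at h
    simp only [characterSpherical, mul_assoc]
    rw [← h, translate_mul_left, ← translate_p0_mul_p0, mul_assoc, characterFunctional_mul_p0_mul,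
      translate_p0_mul_p0]
  map_inv g := by
    -- Multiplying by `p₀` on the right does not change the value, and `(δ_g p₀)^* p₀ = p₀ δ_{g⁻¹}
    -- p₀`.
    rw [characterSpherical, characterSpherical, ← characterFunctional_star,
      ← characterFunctional_mul_p0 _ _ _ _ _ (star _), star_translate_mul, star_p0,
      characterFunctional_p0_mul]

theorem norm_characterSpherical_le (g : G) :
    ‖characterSpherical μ U hU hμ χ g‖ ≤ ‖characterFunctional μ U hU hμ χ‖ := by
  refine (ContinuousLinearMap.le_opNorm _ _).trans ?_
  rw [norm_translate]
  exact mul_le_of_le_one_right (norm_nonneg _) (norm_p0_le μ U hU hμ)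

/-- The functional does not see the passage from `f` to `f p₀`, and `f p₀` is a limit of
combinations of translates of `p₀`. On those, nonnegativity is exactly positive definiteness. -/
theorem characterFunctional_star_mul_self_nonneg
    (hpos : IsPositiveDefinite (characterSpherical μ U hU hμ χ)) (f : L1 μ) :
    0 ≤ characterFunctional μ U hU hμ χ (star f * f) := by
  have h1 : characterFunctional μ U hU hμ χ (star f * f) =
      characterFunctional μ U hU hμ χ (star (f * p0 μ U hU hμ) * (f * p0 μ U hU hμ)) := by
    rw [star_mul, star_p0, mul_assoc, characterFunctional_p0_mul, ← mul_assoc,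
      characterFunctional_mul_p0]
  rw [h1]
  have hcl : IsClosed {h : L1 μ | 0 ≤ characterFunctional μ U hU hμ χ (star h * h)} :=
    isClosed_le continuous_const ((characterFunctional μ U hU hμ χ).continuous.comp
      (continuous_star.mul continuous_id))
  refine closure_minimal (fun h hh => ?_) hcl (mul_p0_mem_closure μ U hU hμ f)
  obtain ⟨m, z, k, rfl⟩ := Submodule.mem_span_set'.1 hh
  choose s hs using fun i => (k i).2
  simp only [← hs, Set.mem_ofPred_eq]
  rw [star_sum_mul_sum_translate_p0]
  simp only [_root_.map_sum, map_smul, characterFunctional_p0_mul]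
  convert hpos m s z using 5
  rw [characterSpherical, smul_eq_mul]
  ring

/-- Positive definiteness makes `f ↦ χ(p₀ f p₀)` a positive functional on all of `L¹(G)`; its GNS
representation realizes `χ` as a vector state of `L¹(G)` at the unit vector given by `p₀`. -/
theorem norm_character_le_norm_toCStarEnv_coe
    (h : ∀ ω : G → ℂ, IsStarSpherical μ U ω → (∃ C : ℝ, ∀ g, ‖ω g‖ ≤ C) → IsPositiveDefinite ω)
    (hU : IsOpen (U : Set G)) (hμ : μ U = 1) (f : biinvSubalgebra μ U) :
    ‖χ f‖ ≤ ‖toCStarEnv (L1 μ) (f : L1 μ)‖ := by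
  by_cases hf : χ f = 0
  · rw [hf, norm_zero]
    exact norm_nonneg _
  have h1 := characterFunctional_p0 μ U hU hμ χ hf
  let φ : PosFunctional (L1 μ) :=
    { toCLM := characterFunctional μ U hU hμ χ
      map_star := characterFunctional_star μ U hU hμ χ
      nonneg := characterFunctional_star_mul_self_nonneg μ U hU hμ χ
        (h _ (isStarSpherical_characterSpherical μ U hU hμ χ h1)
          ⟨_, norm_characterSpherical_le μ U hU hμ χ⟩) }
  have h2 := φ.norm_apply_le_gns (p0 μ U hU hμ) (f : L1 μ)
  rw [star_p0, p0_mul_p0, p0_mul μ U hU hμ f.2, mul_p0 μ U hU hμ f.2] at h2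
  change ‖characterFunctional μ U hU hμ χ f‖ ≤
    _ * (characterFunctional μ U hU hμ χ (p0 μ U hU hμ)).re at h2
  rw [h1, Complex.one_re, mul_one, characterFunctional_coe] at h2
  exact h2.trans (φ.gns.norm_le_norm_toCStarEnv _)

end CharacterToSpherical

/-! ### Bijectivity of `Π` from a lower norm bound. -/

section Surjectivity

variable {G : Type u} [Group G] [TopologicalSpace G] [IsTopologicalGroup G]
  [LocallyCompactSpace G] [MeasurableSpace G] [BorelSpace G]
variable (μ : Measure G) [μ.IsHaarMeasure] [μ.Regular] [μ.IsMulRightInvariant]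
variable (U : Subgroup G) (hU : IsOpen (U : Set G)) (hμ : μ U = 1)

theorem envIncl_toCStarEnv (f : biinvSubalgebra μ U) :
    envIncl μ U (toCStarEnv (biinvSubalgebra μ U) f) = toCStarEnv (L1 μ) (f : L1 μ) :=
  CStarEnv.map_toCStarEnv _ f

theorem norm_le_norm_envIncl
    (h : ∀ f : biinvSubalgebra μ U,
      ‖toCStarEnv (biinvSubalgebra μ U) f‖ ≤ ‖toCStarEnv (L1 μ) (f : L1 μ)‖)
    (x : CStarEnv (biinvSubalgebra μ U)) : ‖x‖ ≤ ‖envIncl μ U x‖ := by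
  have hc : Continuous (envIncl μ U) := CStarEnv.continuous_map _
  refine (denseRange_toCStarEnv (A := biinvSubalgebra μ U)).induction_on
    (p := fun x => ‖x‖ ≤ ‖envIncl μ U x‖) x (isClosed_le continuous_norm hc.norm) fun f => ?_
  rw [envIncl_toCStarEnv]
  exact h f

/-- A map that is bounded below on a complete space is injective with closed range. The range
contains the compressions `p₀ f p₀` of the dense subalgebra `L¹(G)`, hence the whole corner. -/
theorem canonicalMap_bijective_of_norm_le
    (h : ∀ f : biinvSubalgebra μ U,
      ‖toCStarEnv (biinvSubalgebra μ U) f‖ ≤ ‖toCStarEnv (L1 μ) (f : L1 μ)‖) :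
    Function.Bijective (canonicalMap μ U hU hμ) := by
  have hc : Continuous (envIncl μ U) := CStarEnv.continuous_map _
  have hanti : AntilipschitzWith 1 (envIncl μ U) :=
    AddMonoidHomClass.antilipschitz_of_bound (envIncl μ U) fun x => by
      simpa using norm_le_norm_envIncl μ U h x
  have hclosed : IsClosed (Set.range (envIncl μ U)) :=
    hanti.isClosed_range (uniformContinuous_addMonoidHom_of_continuous hc)
  refine ⟨fun x y hxy => hanti.injective (congrArg Subtype.val hxy), ?_⟩
  rintro ⟨_, c, rfl⟩
  have hmem : cstarP0 μ U hU hμ * c * cstarP0 μ U hU hμ ∈ Set.range (envIncl μ U) := by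
    refine (denseRange_toCStarEnv (A := L1 μ)).induction_on
      (p := fun c => cstarP0 μ U hU hμ * c * cstarP0 μ U hU hμ ∈ Set.range (envIncl μ U)) c
      (hclosed.preimage ((continuous_const.mul continuous_id).mul continuous_const)) fun f => ?_
    refine ⟨toCStarEnv _ (compress μ U hU hμ f), ?_⟩
    rw [envIncl_toCStarEnv, coe_compress, map_mul, map_mul, cstarP0]
  obtain ⟨x, hx⟩ := hmem
  exact ⟨x, Subtype.ext hx⟩

end Surjectivity

end GelfandPair

namespace GelfandPair

/-! ### From spherical functions to `*`-characters, and positivity from injectivity of `Π`. -/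

section SphericalToCharacter

variable {G : Type u} [Group G] [TopologicalSpace G] [IsTopologicalGroup G]
  [LocallyCompactSpace G] [MeasurableSpace G] [BorelSpace G]
variable (μ : Measure G) [μ.IsHaarMeasure] [μ.Regular] [μ.IsMulRightInvariant]
variable (U : Subgroup G) (hU : IsOpen (U : Set G)) (hμ : μ U = 1)

theorem integrable_mul_of_bounded {ω : G → ℂ} (hω : Continuous ω) {C : ℝ} (hC : ∀ g, ‖ω g‖ ≤ C)
    (f : L1 μ) : Integrable (fun x => f.toLp x * ω x) μ :=
  (L1.integrable_coeFn f.toLp).mul_bdd hω.measurable.aestronglyMeasurable (.of_forall hC)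

/-- Integration of elements of `L¹(G)` against a bounded continuous function. -/
noncomputable def integralAgainst {ω : G → ℂ} (hω : Continuous ω) {C : ℝ}
    (hC : ∀ g, ‖ω g‖ ≤ C) : L1 μ →L[ℂ] ℂ :=
  LinearMap.mkContinuous
    { toFun := fun f => ∫ x, f.toLp x * ω x ∂μ
      map_add' := fun f g => by
        rw [← integral_add (integrable_mul_of_bounded μ hω hC f)
          (integrable_mul_of_bounded μ hω hC g)]
        refine integral_congr_ae ?_
        filter_upwards [Lp.coeFn_add f.toLp g.toLp] with x hx
        rw [← add_mul]
        exact congrArg (· * ω x) hx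
      map_smul' := fun c f => by
        rw [RingHom.id_apply, smul_eq_mul, ← integral_const_mul]
        refine integral_congr_ae ?_
        filter_upwards [Lp.coeFn_smul c f.toLp] with x hx
        rw [← mul_assoc]
        exact congrArg (· * ω x) hx } C
    fun f => by
      have hf : ‖f‖ = ∫ x, ‖f.toLp x‖ ∂μ := L1.norm_eq_integral_norm f.toLp
      rw [hf, ← integral_const_mul]
      refine norm_integral_le_of_norm_le ((L1.integrable_coeFn f.toLp).norm.const_mul C)
        (.of_forall fun x => ?_)
      rw [norm_mul, mul_comm]
      exact mul_le_mul_of_nonneg_right (hC x) (norm_nonneg _)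

variable {ω : G → ℂ} (hω : IsStarSpherical μ U ω) {C : ℝ} (hC : ∀ g, ‖ω g‖ ≤ C)

theorem integralAgainst_apply {ω : G → ℂ} (hω : Continuous ω) (hC : ∀ g, ‖ω g‖ ≤ C) (f : L1 μ) :
    integralAgainst μ hω hC f = ∫ x, f.toLp x * ω x ∂μ := rfl

theorem integralAgainst_translate {ω : G → ℂ} (hω : Continuous ω) (hC : ∀ g, ‖ω g‖ ≤ C) (y : G)
    (f : L1 μ) :
    integralAgainst μ hω hC (translate μ y f) = ∫ x, f.toLp x * ω (y * x) ∂μ := by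
  rw [integralAgainst_apply,
    ← integral_mul_left_eq_self (fun x => f.toLp x * ω (y * x)) y⁻¹]
  refine integral_congr_ae ?_
  filter_upwards [lTrans_ae μ y f.toLp] with x hx
  rw [mul_inv_cancel_left]
  exact congrArg (· * ω x) hx

theorem integralAgainst_translate_p0 (y : G) :
    integralAgainst μ hω.continuous hC (translate μ y (p0 μ U hU hμ)) = ω y := by
  rw [integralAgainst_translate]
  have h : (fun x => (p0 μ U hU hμ).toLp x * ω (y * x)) =ᵐ[μ]
      (U : Set G).indicator fun _ => ω y := by
    filter_upwards [p0_ae μ U hU hμ] with x hx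
    rw [hx]
    by_cases hxU : x ∈ (U : Set G)
    · have := hω.biinvariant y 1 U.one_mem x hxU
      rw [one_mul] at this
      simp [hxU, this]
    · simp [hxU]
  rw [integral_congr_ae h, integral_indicator hU.measurableSet, setIntegral_const,
    measureReal_def, hμ, ENNReal.toReal_one, one_smul]

theorem integralAgainst_translate_p0_mul_translate_p0 (y x : G) :
    integralAgainst μ hω.continuous hC
      (translate μ y (p0 μ U hU hμ * translate μ x (p0 μ U hU hμ))) = ω y * ω x := by
  have h := clm_p0_mul_eq_setIntegral μ U hU hμ
    ((integralAgainst μ hω.continuous hC).comp (translate μ y)) (translate μ x (p0 μ U hU hμ))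
  rw [ContinuousLinearMap.comp_apply] at h
  rw [h, ← hω.integral_eq]
  simp only [ContinuousLinearMap.comp_apply, ← translate_mul, mul_assoc,
    integralAgainst_translate_p0 μ U hU hμ hω hC]

/-- Biinvariance gives `f = p₀ f p₀ = ∫ f(x) p₀ δ_x p₀ dμ(x)`. After translation by `y` the
functional equation turns the integrand into `f(x) ω(y) ω(x)`. -/
theorem integralAgainst_translate_of_mem (hU : IsOpen (U : Set G)) (hμ : μ U = 1) (y : G)
    {f : L1 μ} (hf : f ∈ biinvSubalgebra μ U) :
    integralAgainst μ hω.continuous hC (translate μ y f) =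
      ω y * integralAgainst μ hω.continuous hC f := by
  let L : L1 μ →L[ℂ] ℂ := (integralAgainst μ hω.continuous hC).comp
    ((translate μ y).comp (ContinuousLinearMap.mul ℂ (L1 μ) (p0 μ U hU hμ)))
  have h : L (f * p0 μ U hU hμ) = _ := clm_mul_eq_integral μ L f (p0 μ U hU hμ)
  have hL : ∀ k, L k = integralAgainst μ hω.continuous hC (translate μ y (p0 μ U hU hμ * k)) :=
    fun k => rfl
  simp only [hL, integralAgainst_translate_p0_mul_translate_p0 μ U hU hμ hω hC] at h
  rw [mul_p0 μ U hU hμ hf, p0_mul μ U hU hμ hf] at h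
  rw [h, integralAgainst_apply, ← integral_const_mul]
  refine integral_congr_ae (.of_forall fun x => ?_)
  simp only [smul_eq_mul]
  ring

/-- In `f * g = ∫ f(y) δ_y g dμ(y)` each translate `δ_y g` contributes the factor `ω(y)`, so
biinvariance of `g` alone suffices. -/
theorem integralAgainst_mul (hU : IsOpen (U : Set G)) (hμ : μ U = 1) (f : L1 μ) {g : L1 μ}
    (hg : g ∈ biinvSubalgebra μ U) :
    integralAgainst μ hω.continuous hC (f * g) =
      integralAgainst μ hω.continuous hC f * integralAgainst μ hω.continuous hC g := by
  rw [clm_mul_eq_integral]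
  simp only [integralAgainst_translate_of_mem μ U hω hC hU hμ _ hg, smul_eq_mul, ← mul_assoc]
  rw [integral_mul_const]
  rfl

theorem integralAgainst_star (f : L1 μ) :
    integralAgainst μ hω.continuous hC (star f) =
      conj (integralAgainst μ hω.continuous hC f) := by
  rw [integralAgainst_apply, integralAgainst_apply, ← integral_conj]
  have := isInvInvariant μ
  rw [← integral_inv_eq_self (fun x => conj (f.toLp x * ω x))]
  refine integral_congr_ae ?_
  filter_upwards [invol_ae μ f.toLp] with x hx
  rw [map_mul, ← hω.map_inv, inv_inv]
  exact congrArg (· * ω x) hx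

/-- The `*`-character of `L¹(U\G/U)` attached to a bounded `*`-spherical function. -/
noncomputable def sphericalCharacter (hU : IsOpen (U : Set G)) (hμ : μ U = 1) :
    biinvSubalgebra μ U →⋆ₙₐ[ℂ] ℂ where
  toFun f := integralAgainst μ hω.continuous hC (f : L1 μ)
  map_smul' c f := map_smul (integralAgainst μ hω.continuous hC) c (f : L1 μ)
  map_zero' := map_zero (integralAgainst μ hω.continuous hC)
  map_add' f g := map_add (integralAgainst μ hω.continuous hC) (f : L1 μ) (g : L1 μ)
  map_mul' f g := integralAgainst_mul μ U hω hC hU hμ (f : L1 μ) g.2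
  map_star' f := integralAgainst_star μ U hω hC (f : L1 μ)

/-- If `C^*(L¹(U\G/U))` embeds in `C^*(G)`, then `*`-characters of `L¹(U\G/U)` that are normalized
at `p₀` are nonnegative on the elements `b^* b ∈ L¹(U\G/U)`, `b ∈ L¹(G) p₀`. -/
theorem character_nonneg_of_injective (hinj : Function.Injective (envIncl μ U))
    (χ : biinvSubalgebra μ U →⋆ₙₐ[ℂ] ℂ) (hχ : χ ⟨p0 μ U hU hμ, p0_mem μ U hU hμ⟩ = 1)
    {b : L1 μ} (hb : b * p0 μ U hU hμ = b) {f : biinvSubalgebra μ U}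
    (hf : (f : L1 μ) = star b * b) : 0 ≤ χ f := by
  set e : biinvSubalgebra μ U := ⟨p0 μ U hU hμ, p0_mem μ U hU hμ⟩
  set t : ℝ := ‖b‖ * ‖b‖
  have hsa : star f = f := Subtype.ext (by rw [StarMemClass.coe_star, hf, star_mul, star_star])
  have hreal : conj (χ f) = χ f := by
    have := map_star χ f
    rw [hsa] at this
    exact this.symm
  -- This bound is taken in `C^*(G)`, where `b` itself is represented and `ρ(f) = ρ(b)^* ρ(b)`.
  -- Representations of `L¹(U\G/U)` alone need not make `f` positive.
  have h1 : ‖toCStarEnv (L1 μ) (((t : ℂ) • e - f : biinvSubalgebra μ U) : L1 μ)‖ ≤ t := by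
    refine norm_toCStarEnv_le (by positivity) fun ρ => ?_
    have hcoe : (((t : ℂ) • e - f : biinvSubalgebra μ U) : L1 μ) =
        (t : ℂ) • p0 μ U hU hμ - star b * b := by rw [← hf]; rfl
    rw [hcoe, map_sub, map_smul, map_mul, map_star]
    refine norm_smul_sub_star_mul_self_le ((isStarProjection_p0 μ U hU hμ).map ρ.toHom) ?_ ?_
    · rw [← map_mul, hb]
    · exact mul_le_mul (ρ.norm_le b) (ρ.norm_le b) (norm_nonneg _) (norm_nonneg _)
  have h2 : ‖χ ((t : ℂ) • e - f)‖ ≤ t := by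
    refine (norm_character_le_norm_toCStarEnv χ _).trans ?_
    -- Injective `*`-homomorphisms between `C^*`-algebras are isometric, so the bound descends to
    -- `C^*(L¹(U\G/U))`, where it controls `χ`.
    rw [← NonUnitalStarAlgHom.norm_map (envIncl μ U) hinj, envIncl_toCStarEnv]
    exact h1
  rw [map_sub, map_smul, hχ, smul_eq_mul, mul_one] at h2
  -- Now `t - Re χ(f) ≤ |t - χ(f)| ≤ t`.
  have h3 := (Complex.re_le_norm _).trans h2
  rw [Complex.sub_re, Complex.ofReal_re] at h3
  exact Complex.nonneg_iff.2 ⟨by linarith, (Complex.conj_eq_iff_im.1 hreal).symm⟩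

theorem isPositiveDefinite_of_injective (hinj : Function.Injective (envIncl μ U))
    (hU : IsOpen (U : Set G)) (hμ : μ U = 1) {ω : G → ℂ} (hω : IsStarSpherical μ U ω) {C : ℝ}
    (hC : ∀ g, ‖ω g‖ ≤ C) : IsPositiveDefinite ω := by
  intro m s z
  let χ := sphericalCharacter μ U hω hC hU hμ
  have htr : ∀ g, integralAgainst μ hω.continuous hC
      (p0 μ U hU hμ * translate μ g (p0 μ U hU hμ)) = ω g := fun g => by
    have h := integralAgainst_translate_p0_mul_translate_p0 μ U hU hμ hω hC 1 g
    rwa [translate_one, hω.map_one, one_mul] at h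
  have hχ : χ ⟨p0 μ U hU hμ, p0_mem μ U hU hμ⟩ = 1 := by
    have h := integralAgainst_translate_p0 μ U hU hμ hω hC 1
    rwa [translate_one, hω.map_one] at h
  -- With this `b`, the value of the character of `ω` at `b^* b` is the sum to be shown nonnegative.
  set b : L1 μ := ∑ k, z k • translate μ (s k) (p0 μ U hU hμ) with hbdef
  have hb : b * p0 μ U hU hμ = b := by
    simp only [hbdef, Finset.sum_mul, smul_mul_assoc, translate_p0_mul_p0]
  have hmem : star b * b ∈ biinvSubalgebra μ U := by
    refine mem_biinvSubalgebra_of_p0_mul μ U hU hμ ?_ ?_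
    · conv_rhs => rw [← hb, star_mul, star_p0, mul_assoc, hb]
    · rw [mul_assoc, hb]
  have h := character_nonneg_of_injective μ U hU hμ hinj χ hχ hb (f := ⟨star b * b, hmem⟩) rfl
  replace h : 0 ≤ integralAgainst μ hω.continuous hC (star b * b) := h
  rw [star_sum_mul_sum_translate_p0] at h
  simp only [_root_.map_sum, map_smul, htr] at h
  convert h using 5
  rw [smul_eq_mul]
  ring

end SphericalToCharacter

end GelfandPair

theorem mainTheorem3 {G : Type u} [Group G] [TopologicalSpace G] [IsTopologicalGroup G]
    [LocallyCompactSpace G] [T2Space G] [MeasurableSpace G] [BorelSpace G]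
    (μ : Measure G) [μ.IsHaarMeasure] [μ.Regular] [μ.IsMulRightInvariant]
    (U : Subgroup G) (hUopen : IsOpen (U : Set G)) (hUcompact : IsCompact (U : Set G))
    (hμU : μ U = 1) (hGelfand : GelfandPair.IsGelfandPair μ U) :
    (∀ ω : G → ℂ, GelfandPair.IsStarSpherical μ U ω → (∃ C : ℝ, ∀ g, ‖ω g‖ ≤ C) →
        GelfandPair.IsPositiveDefinite ω) ↔
      Function.Bijective (GelfandPair.canonicalMap μ U hUopen hμU) := by
  constructor
  · intro h
    refine GelfandPair.canonicalMap_bijective_of_norm_le μ U hUopen hμU fun f => ?_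
    -- Commutativity enters here: it reduces the comparison of the two enveloping norms to one
    -- `*`-character at a time.
    refine GelfandPair.norm_toCStarEnv_le_of_forall_character
      (A := GelfandPair.biinvSubalgebra μ U)
      (fun a b => Subtype.ext (hGelfand a a.2 b b.2)) (norm_nonneg _) fun χ => ?_
    exact GelfandPair.norm_character_le_norm_toCStarEnv_coe μ U χ h hUopen hμU f
  · rintro ⟨hinj, -⟩ ω hω ⟨C, hC⟩
    exact GelfandPair.isPositiveDefinite_of_injective μ U
      (fun x y hxy => hinj (Subtype.ext hxy)) hUopen hμU hω hC
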